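/- Let $\gamma\in(1,\tfrac53)$ and $a=\frac{\gamma-1}{\gamma+1}$, $\kappa=\sqrt{1-a}$, $\nu=\frac{\sqrt{1-a^2}}{a}$, $\zeta=\frac{a}{1+a}$. For $q>0$ define $$\overleftarrow\phi(q)=\begin{cases}q^{-1/\gamma}&q\le1\\ \frac{1+aq}{q+a}&q>1\end{cases},\quad \overleftarrow\psi(q)=\begin{cases}\nu(q^\zeta-1)&q\le1\\ \frac{\kappa(q-1)}{\sqrt{q+a}}&q>1\end{cases},\quad \overrightarrow\phi(q)=\begin{cases}q^{-1/\gamma}&q\ge1\\ \frac{1+aq}{q+a}&q<1\end{cases},\quad \overrightarrow\psi(q)=\begin{cases}\nu(q^\zeta-1)&q\ge1\\ \frac{\kappa(q-1)}{\sqrt{q+a}}&q<1\end{cases}.$$ For the one-dimensional compressible Euler system of an ideal polytropic gas with adiabatic constant $\gamma$ (specific volume $\tau>0$, velocity $u$, pressure $p>0$), a left state $(\bar\tau,\bar u,\bar p)$ is joined to $(\overleftarrow\phi(b)\bar\tau,\ \bar u-\overleftarrow\psi(b)\sqrt{\bar\tau\bar p},\ b\bar p)$ by a backward wave of strength $b$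 (a rarefaction $R$ if $0<b<1$, a compressive shock $S$ if $b>1$), to $(c\bar\tau,\bar u,\bar p)$ by a contact of strength $c>0$, and to $(\overrightarrow\phi(f)\bar\tau,\ \bar u+\overrightarrow\psi(f)\sqrt{\bar\tau\bar p},\ f\bar p)$ by a forward wave of strength $f$ (a rarefaction if $f>1$, a compressive shock if $0<f<1$). The Riemann problem between a left state $(\bar\tau,\bar u,\bar p)$ and a right state $(\tau,u,p)$ is solved by a backward wave $B$, a contact $C$ and a forward wave $F$ (in this order from left to right, with $B,C,F>0$); if $u-\bar u\ge\frac{2}{\gamma-1}(\sqrt{\gamma\tau p}+\sqrt{\gamma\bar\tau\bar p})$, it is instead solved by a backward and a forward rarefaction separated by a vacuum, and we set $B=0$, $F=+\infty$. Let a backward wave of strength $x$ be followed on its right by a backward wave of strength $y$, where $x,y>1$ ($SS$), or $0<y<1<x$ ($SR$), or $0<x<1<y$ ($RS$). Consider the Riemann problem between the extreme left and extreme right states. It has exactly one solution in the above sense, and this solution depends only on $x$ and $y$ (and $\gamma$); write $B(x,y)$ and $F(x,y)$ for the strengths of its backward (transmitted) and forward (reflected) waves. Put $$H(x,y)=\overleftarrow\psi(xy)-\overleftarrow\psi(x)-\overleftarrow\psi(y)\sqrt{x\overleftarrow\phi(x)},\qquad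 \hat y=\Big[\tfrac12\big(1-\sqrt\zeta\big)\Big]^{1/\zeta}.$$ (a) In $SS$ interactions $F>1$: the reflected wave is a rarefaction. (b) The function $\alpha=\overrightarrow\psi-\overleftarrow\psi$ on $(0,\infty)$ has exactly one root $y_0$ different from $1$, and $0<y_0<1$; put $x_0=1/y_0$. In the region $0<y<1<x$ ($SR$ interactions), the set $\{B=1\}$ is the graph $y=k(x)$ of a function $k:(1,\infty)\to(0,1)$, and the set $\{H=0\}$ equals $\{F=1\}$ and is the graph $y=h(x)$ of a function $h:(1,\infty)\to(0,1)$. There the reflected wave is a rarefaction ($F>1$) if and only if $y<h(x)$, and a shock ($F<1$) if and only if $y>h(x)$. Moreover: - the graphs $y=h(x)$, $y=k(x)$ and $y=\frac1x$ all pass through $(x_0,y_0)$; - $h(x)<k(x)<\frac1x$ for $1<x<x_0$; - $h(x)>k(x)>\frac1x$ for $x>x_0$; - $h(x)$ tends to a limit $y_*\in(\hat y,1)$ as $x\to+\infty$, and $\displaystyle\lim_{x\downarrow1}h(x)=\Big[\frac{3}{4(1-a)}\Big]^{1/\zeta}<1$. (c) In $RS$ interactions $F<1$: the reflected wave is a shock.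 -/

import Mathlib

open scoped ENNReal Topology

noncomputable section

namespace GasDyn

/-- A state `(τ, u, p)` of the gas: specific volume, velocity, pressure. -/
@[ext]
structure GasState where
  τ : ℝ
  u : ℝ
  p : ℝ

/-- `a = (γ - 1) / (γ + 1)`. -/
def aPar (γ : ℝ) : ℝ := (γ - 1) / (γ + 1)

/-- `κ = √(1 - a)`. -/
def kappaPar (γ : ℝ) : ℝ := √(1 - aPar γ)

/-- `ν = √(1 - a²) / a`. -/
def nuPar (γ : ℝ) : ℝ := √(1 - aPar γ ^ 2) / aPar γ

/-- `ζ = a / (1 + a) = (γ - 1) / (2 γ)`. -/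
def zetaPar (γ : ℝ) : ℝ := aPar γ / (1 + aPar γ)

/-- Specific-volume ratio across a backward wave with pressure ratio `b`. -/
def phiB (γ b : ℝ) : ℝ :=
  if b ≤ 1 then b ^ (-1 / γ) else (1 + aPar γ * b) / (b + aPar γ)

/-- Specific-volume ratio across a forward wave with pressure ratio `f`. -/
def phiF (γ f : ℝ) : ℝ :=
  if 1 ≤ f then f ^ (-1 / γ) else (1 + aPar γ * f) / (f + aPar γ)

/-- Normalized velocity jump across a backward wave with pressure ratio `b`. -/
def psiB (γ b : ℝ) : ℝ :=
  if b ≤ 1 then nuPar γ * (b ^ zetaPar γ - 1)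
  else kappaPar γ * (b - 1) / √(b + aPar γ)

/-- Normalized velocity jump across a forward wave with pressure ratio `f`. -/
def psiF (γ f : ℝ) : ℝ :=
  if 1 ≤ f then nuPar γ * (f ^ zetaPar γ - 1)
  else kappaPar γ * (f - 1) / √(f + aPar γ)

/-- The state to the right of a backward wave of strength (right/left pressure ratio) `b` whose
left state is `s`: a rarefaction if `0 < b < 1`, a compressive shock if `b > 1`, and no wave if
`b = 1`. -/
def backwardWave (γ b : ℝ) (s : GasState) : GasState where
  τ := phiB γ b * s.τ
  u := s.u - psiB γ b * √(s.τ * s.p)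
  p := b * s.p

/-- The state to the right of a contact with specific-volume ratio `c` and left state `s`. -/
def contactWave (c : ℝ) (s : GasState) : GasState where
  τ := c * s.τ
  u := s.u
  p := s.p

/-- The state to the right of a forward wave of strength (right/left pressure ratio) `f` whose
left state is `s`: a rarefaction if `f > 1`, a compressive shock if `0 < f < 1`, and no wave if
`f = 1`. -/
def forwardWave (γ f : ℝ) (s : GasState) : GasState where
  τ := phiF γ f * s.τ
  u := s.u + psiF γ f * √(s.τ * s.p)
  p := f * s.p

/-- The sound speed in Lagrangian form used for the vacuum criterion: `𝔠² = γ τ p`. -/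
def soundSpeed (γ : ℝ) (s : GasState) : ℝ := √(γ * s.τ * s.p)

/-- The condition on the left state `l` and right state `r` for the Riemann problem to have a
solution free of vacuum. -/
def VacuumFree (γ : ℝ) (l r : GasState) : Prop :=
  r.u - l.u < 2 / (γ - 1) * (soundSpeed γ r + soundSpeed γ l)

/-- Possible wave fans that resolve a Riemann problem: a backward wave `B`, a contact `C` and a
forward wave `F` separated by non-vacuum states, or a backward and a forward rarefaction
separated by a vacuum `(τ, p) = (∞, 0)`. -/
inductive WaveFan where
  | regular (B C F : ℝ)
  | vacuum

/-- The wave fan resolves the Riemann problem with left state `l` and right state `r`. -/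
def WaveFan.Resolves (γ : ℝ) (l r : GasState) : WaveFan → Prop
  | .regular B C F =>
      0 < B ∧ 0 < C ∧ 0 < F ∧ forwardWave γ F (contactWave C (backwardWave γ B l)) = r
  | .vacuum => ¬ VacuumFree γ l r

/-- Pressure ratio of the outgoing backward wave. It is `0` if the wave ends in the vacuum. -/
def WaveFan.backwardStrength : WaveFan → ℝ
  | .regular B _ _ => B
  | .vacuum => 0

/-- Pressure ratio of the outgoing forward wave, in `[0, ∞]`. It is `∞` for the forward
rarefaction that starts from the vacuum (where the pressure is `0`). -/
def WaveFan.forwardStrength : WaveFan → ℝ≥0∞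
  | .regular _ _ F => ENNReal.ofReal F
  | .vacuum => ⊤

/-- The extreme right state in the interaction of two backward waves of strengths `x` (left) and
`y` (right), when the extreme left state is `l`. -/
def overtakingRight (γ x y : ℝ) (l : GasState) : GasState :=
  backwardWave γ y (backwardWave γ x l)

/-- The strengths of two backward waves (left `x`, right `y`), of which one overtakes the other:
shock-shock, shock-rarefaction or rarefaction-shock. Two rarefactions do not meet. -/
def IsOvertaking (x y : ℝ) : Prop :=
  (1 < x ∧ 1 < y) ∨ (1 < x ∧ 0 < y ∧ y < 1) ∨ (0 < x ∧ x < 1 ∧ 1 < y)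

/-- `M(q) = √(q φ(q))`, with `φ` for backward waves. -/
def MFun (γ q : ℝ) : ℝ := √(q * phiB γ q)

/-- `H(x, y) = ψ(x y) - ψ(x) - ψ(y) M(x)`, with `ψ` for backward waves. -/
def HFun (γ x y : ℝ) : ℝ := psiB γ (x * y) - psiB γ x - psiB γ y * MFun γ x

/-- `α(q)`: forward `ψ(q)` minus backward `ψ(q)`. -/
def alphaFun (γ q : ℝ) : ℝ := psiF γ q - psiB γ q

/-- `ŷ(γ) = [(1 - √ζ) / 2] ^ (1 / ζ)`. -/
def yHat (γ : ℝ) : ℝ := ((1 - √(zetaPar γ)) / 2) ^ (1 / zetaPar γ)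

/-- `y₁(γ) = [3 / (4 (1 - a))] ^ (1 / ζ)`. -/
def yOne (γ : ℝ) : ℝ := (3 / (4 * (1 - aPar γ))) ^ (1 / zetaPar γ)

end GasDyn

end

/-!
Write `a = aPar γ`, `ζ = a / (1 + a)`, and divide all velocity jumps by `κ`. The condition `γ < 5/3`
means `a < 1/4`.

**The Riemann problem.** Let two backward waves of strengths `x`, `y` interact. The pressure and
specific-volume equations give `F = x y / B` and the strength of the contact, and reflection turns
the forward wave into a backward wave of strength `1 / F`. What remains is one equation for `B`,
`fanDefect a x y B = 0`, whose left side is continuous and strictly increasing on `[0, ∞)`. It has a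
root exactly if the defect is negative at `B = 0`, which is the vacuum-free condition, and the root
is unique (`resolves_iff_eq_outgoingFan`). The value of the defect at `B = x y` is `H(x, y) / κ`, so
the reflected wave is a rarefaction, absent or a shock according to the sign of `H`
(`forwardStrength_iff`); the value at `B = 1` decides on `B = 1` (`backwardStrength_eq_one_iff`).

**Convexity.** In the acoustic variable `s = q ^ ζ` the rarefaction curve is a straight line, and the
shock curve is tangent to it at `s = 1`. The logarithmic derivative of the slope of the Hugoniot
curve vanishes only at the pressure ratios `1` and `2 a (1 + 2 a) / (1 - a)`, the latter being less
than `1`. Hence the whole wave curve is convex in `s` (`convexOn_jump_rpow`), and this decides most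
of the signs:
* For a rarefaction followed by a shock, `H < 0` is Jensen's inequality.
* For a shock followed by a rarefaction, `H(x, ·)` is convex in `s`, positive at `s = 0`, and zero
  with positive slope at `s = 1`. So it changes its sign exactly once on `(0, 1)`, and this gives
  `h` (`exists_jumpDefect_sign`).
* `α` is convex in `s` up to the inflection point and increases to `0` from there on, which gives
  its unique root `y₀` (`exists_shock_rarefaction_crossing`).
* The defect at `B = 1` is strictly decreasing in `y`, since a secant slope of the wave curve is
  monotone; this gives `k` (`transmittedDefect_strictAntiOn`).

For two shocks, `∂H/∂y > 0` reduces to a polynomial inequality (`overtaking_polynomial_ineq`), whose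
case `y = 1` also gives the positive slope used above.

**Position of the curves.** On `x y = 1` the defect at `B = 1` equals `α(y) / κ`, so `k(x)` lies below
or above `1 / x` according to the sign of `α(1 / x)`. On `y = k(x)` one has `F = x y`, so that
`h < k` if and only if `k(x) < 1 / x`.

**Limits.** As `x → ∞`, `H(x, y) / √x` tends to a function of `y` that again changes its sign exactly
once on `(0, 1)`; its root is `y_*` (`exists_strongShockDefect_sign`). For `x y ≤ 1` the equation
`H = 0` is linear in `y ^ ζ`, and the solution is a quotient of two functions that vanish to third
order at `x = 1`; comparing the leading coefficients gives the limit at `x = 1`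
(`tendsto_zero_of_jumpDefect`).
-/

namespace GasDyn

/-! ### The shock curve in the acoustic variable -/

/-- Velocity jump across a compressive shock with pressure ratio `q`, divided by `κ`. The formula
is used for every `q ≥ 0`, also on the part `q < 1` of the Hugoniot curve. -/
noncomputable def shockJump (a q : ℝ) : ℝ := (q - 1) / √(q + a)

/-- Slope of the shock curve with respect to the acoustic variable `s = q ^ (a / (1 + a))`,
written as a function of the pressure ratio `q`. -/
noncomputable def shockSlope (a z : ℝ) : ℝ :=
  (z + 1 + 2 * a) / (2 * (z + a) * √(z + a)) * z ^ (1 / (1 + a)) * ((1 + a) / a)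

lemma hasDerivAt_shockJump {a q : ℝ} (h : 0 < q + a) :
    HasDerivAt (shockJump a) ((q + 1 + 2 * a) / (2 * (q + a) * √(q + a))) q := by
  have h1 : HasDerivAt (fun q : ℝ => √(q + a)) (1 / (2 * √(q + a))) q :=
    ((hasDerivAt_id q).add_const a).sqrt h.ne'
  have hs : 0 < √(q + a) := Real.sqrt_pos.2 h
  have h2 := ((hasDerivAt_id q).sub_const 1).div h1 hs.ne'
  refine h2.congr_deriv ?_
  have hsq : √(q + a) ^ 2 = q + a := Real.sq_sqrt h.le
  simp only [id]
  rw [hsq]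
  field_simp
  rw [hsq]
  ring

lemma hasDerivAt_shockJump_rpow {a s : ℝ} (ha : 0 < a) (hs : 0 < s) :
    HasDerivAt (fun s : ℝ => shockJump a (s ^ ((1 + a) / a)))
      (shockSlope a (s ^ ((1 + a) / a))) s := by
  have hz : 0 < s ^ ((1 + a) / a) := Real.rpow_pos_of_pos hs _
  have h1 := Real.hasDerivAt_rpow_const (x := s) (p := (1 + a) / a) (Or.inl hs.ne')
  have h2 := (hasDerivAt_shockJump (a := a) (q := s ^ ((1 + a) / a)) (by positivity)).comp s h1
  refine h2.congr_deriv ?_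
  have h3 : s ^ ((1 + a) / a - 1) = (s ^ ((1 + a) / a)) ^ (1 / (1 + a)) := by
    rw [← Real.rpow_mul hs.le]
    congr 1
    field_simp
    ring
  rw [h3, shockSlope]
  ring

lemma continuousOn_shockJump {a : ℝ} (ha : 0 < a) : ContinuousOn (shockJump a) (Set.Ici 0) :=
  fun q hq => (hasDerivAt_shockJump (by have : 0 ≤ q := hq; positivity)).continuousAt.continuousWithinAt

lemma strictMonoOn_shockJump {a : ℝ} (ha : 0 < a) : StrictMonoOn (shockJump a) (Set.Ici 0) := by
  refine strictMonoOn_of_deriv_pos (convex_Ici 0) (continuousOn_shockJump ha) fun q hq => ?_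
  rw [interior_Ici] at hq
  have hq : 0 < q := hq
  rw [(hasDerivAt_shockJump (by positivity)).deriv]
  positivity

@[simp] lemma shockJump_one (a : ℝ) : shockJump a 1 = 0 := by simp [shockJump]

lemma shockSlope_pos {a z : ℝ} (ha : 0 < a) (hz : 0 < z) : 0 < shockSlope a z := by
  unfold shockSlope; positivity

/-- At `q = 1` the shock curve is tangent to the rarefaction curve. -/
lemma shockSlope_one {a : ℝ} (ha : 0 < a) : shockSlope a 1 = √(1 + a) / a := by
  have h : √(1 + a) ^ 2 = 1 + a := Real.sq_sqrt (by positivity)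
  have hs : 0 < √(1 + a) := Real.sqrt_pos.2 (by positivity)
  rw [shockSlope, Real.one_rpow]
  field_simp
  rw [h]
  ring

/-- The critical points `1` and `2 a (1 + 2 a) / (1 - a)` of the slope are read off from this
logarithmic derivative; the second one is smaller than `1` exactly when `a < 1 / 4`. -/
lemma hasDerivAt_log_shockSlope {a z : ℝ} (ha : 0 < a) (hz : 0 < z) :
    HasDerivAt (fun z => Real.log (shockSlope a z))
      ((z - 1) * ((1 - a) * z - 2 * a * (1 + 2 * a)) /
        (2 * (1 + a) * z * (z + 1 + 2 * a) * (z + a))) z := by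
  have h1 := ((hasDerivAt_id z).add_const (1 + 2 * a)).log (by simp only [id]; positivity)
  have h2 := (((hasDerivAt_id z).add_const a).log (by simp only [id]; positivity)).const_mul (3 / 2)
  have h3 := ((hasDerivAt_id z).log (by simp only [id]; positivity)).const_mul (1 / (1 + a))
  have h4 := ((h1.sub h2).add h3).add_const (Real.log ((1 + a) / a) - Real.log 2)
  refine (h4.congr_of_eventuallyEq ?_).congr_deriv ?_
  · filter_upwards [lt_mem_nhds hz] with w hw
    have hw1 : 0 < w + a := by positivity
    simp only [shockSlope, Pi.add_apply, Pi.sub_apply, id]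
    rw [Real.log_mul (by positivity) (by positivity), Real.log_mul (by positivity) (by positivity),
      Real.log_div (by positivity) (by positivity), Real.log_mul (by positivity) (by positivity),
      Real.log_mul (by positivity) (by positivity), Real.log_sqrt hw1.le, Real.log_rpow hw,
      add_assoc w]
    ring
  · simp only [id]
    field_simp
    ring

lemma continuousOn_log_shockSlope {a : ℝ} (ha : 0 < a) :
    ContinuousOn (fun z => Real.log (shockSlope a z)) (Set.Ioi 0) :=
  fun _ hz => (hasDerivAt_log_shockSlope ha hz).continuousAt.continuousWithinAt

/-- The second critical point of the slope of the shock curve. -/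
noncomputable def inflection (a : ℝ) : ℝ := 2 * a * (1 + 2 * a) / (1 - a)

lemma inflection_pos {a : ℝ} (ha : 0 < a) (ha' : a < 1 / 4) : 0 < inflection a := by
  have : 0 < 1 - a := by linarith
  unfold inflection; positivity

lemma inflection_lt_one {a : ℝ} (ha : 0 < a) (ha' : a < 1 / 4) : inflection a < 1 := by
  have : 0 < 1 - a := by linarith
  rw [inflection, div_lt_one this]
  nlinarith

lemma lt_iff_inflection_lt {a z : ℝ} (ha' : a < 1 / 4) :
    inflection a < z ↔ 0 < (1 - a) * z - 2 * a * (1 + 2 * a) := by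
  have : 0 < 1 - a := by linarith
  rw [inflection, div_lt_iff₀ this]
  constructor <;> intro h <;> linarith

lemma lt_inflection_iff {a z : ℝ} (ha' : a < 1 / 4) :
    z < inflection a ↔ (1 - a) * z - 2 * a * (1 + 2 * a) < 0 := by
  have : 0 < 1 - a := by linarith
  rw [inflection, lt_div_iff₀ this]
  constructor <;> intro h <;> linarith

lemma strictMonoOn_shockSlope_Ici {a : ℝ} (ha : 0 < a) (ha' : a < 1 / 4) :
    StrictMonoOn (shockSlope a) (Set.Ici 1) := by
  have key : StrictMonoOn (fun z => Real.log (shockSlope a z)) (Set.Ici 1) := by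
    refine strictMonoOn_of_deriv_pos (convex_Ici 1)
      ((continuousOn_log_shockSlope ha).mono (Set.Ici_subset_Ioi.2 one_pos)) fun z hz => ?_
    rw [interior_Ici] at hz
    have hz : 1 < z := hz
    have hz0 : 0 < z := by linarith
    rw [(hasDerivAt_log_shockSlope ha hz0).deriv]
    have h1 := (lt_iff_inflection_lt ha').1 ((inflection_lt_one ha ha').trans hz)
    have h2 : 0 < z - 1 := by linarith
    positivity
  intro z hz w hw hzw
  have hz' : 0 < z := lt_of_lt_of_le one_pos hz
  exact (Real.log_lt_log_iff (shockSlope_pos ha hz') (shockSlope_pos ha (hz'.trans hzw))).1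
    (key hz hw hzw)

lemma strictAntiOn_shockSlope_Icc {a : ℝ} (ha : 0 < a) (ha' : a < 1 / 4) :
    StrictAntiOn (shockSlope a) (Set.Icc (inflection a) 1) := by
  have hi := inflection_pos ha ha'
  have key : StrictAntiOn (fun z => Real.log (shockSlope a z)) (Set.Icc (inflection a) 1) := by
    refine strictAntiOn_of_deriv_neg (convex_Icc _ _)
      ((continuousOn_log_shockSlope ha).mono fun z hz => lt_of_lt_of_le hi hz.1) fun z hz => ?_
    rw [interior_Icc] at hz
    have hz0 : 0 < z := hi.trans hz.1
    rw [(hasDerivAt_log_shockSlope ha hz0).deriv]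
    have h1 := (lt_iff_inflection_lt ha').1 hz.1
    have h2 : z - 1 < 0 := by linarith [hz.2]
    exact div_neg_of_neg_of_pos (mul_neg_of_neg_of_pos h2 h1) (by positivity)
  intro z hz w hw hzw
  exact (Real.log_lt_log_iff (shockSlope_pos ha (lt_of_lt_of_le hi hw.1))
    (shockSlope_pos ha (lt_of_lt_of_le hi hz.1))).1 (key hz hw hzw)

lemma strictMonoOn_shockSlope_Ioc {a : ℝ} (ha : 0 < a) (ha' : a < 1 / 4) :
    StrictMonoOn (shockSlope a) (Set.Ioc 0 (inflection a)) := by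
  have key : StrictMonoOn (fun z => Real.log (shockSlope a z)) (Set.Ioc 0 (inflection a)) := by
    refine strictMonoOn_of_deriv_pos (convex_Ioc _ _)
      ((continuousOn_log_shockSlope ha).mono fun z hz => hz.1) fun z hz => ?_
    rw [interior_Ioc] at hz
    have hz0 : 0 < z := hz.1
    rw [(hasDerivAt_log_shockSlope ha hz0).deriv]
    have h1 := (lt_inflection_iff ha').1 hz.2
    have h2 : z - 1 < 0 := by linarith [hz.2, inflection_lt_one ha ha']
    exact div_pos (mul_pos_of_neg_of_neg h2 h1) (by positivity)
  intro z hz w hw hzw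
  exact (Real.log_lt_log_iff (shockSlope_pos ha hz.1) (shockSlope_pos ha hw.1)).1 (key hz hw hzw)

/-! ### Convexity of the wave curve in the acoustic variable -/

/-- Velocity jump across a backward wave with pressure ratio `q`, divided by `κ`. -/
noncomputable def jump (a q : ℝ) : ℝ :=
  if q ≤ 1 then √(1 + a) / a * (q ^ (a / (1 + a)) - 1) else shockJump a q

lemma jump_of_le {q : ℝ} (a : ℝ) (hq : q ≤ 1) :
    jump a q = √(1 + a) / a * (q ^ (a / (1 + a)) - 1) := if_pos hq

lemma jump_of_ge {q : ℝ} (a : ℝ) (hq : 1 ≤ q) : jump a q = shockJump a q := by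
  rcases hq.eq_or_lt with rfl | h
  · simp [jump]
  · exact if_neg h.not_ge

@[simp] lemma jump_one (a : ℝ) : jump a 1 = 0 := by simp [jump]

lemma rpow_rpow_acoustic {a s : ℝ} (ha : 0 < a) (hs : 0 ≤ s) :
    (s ^ ((1 + a) / a)) ^ (a / (1 + a)) = s := by
  rw [← Real.rpow_mul hs, show (1 + a) / a * (a / (1 + a)) = 1 by field_simp, Real.rpow_one]

lemma rpow_acoustic_rpow {a q : ℝ} (ha : 0 < a) (hq : 0 ≤ q) :
    (q ^ (a / (1 + a))) ^ ((1 + a) / a) = q := by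
  rw [← Real.rpow_mul hq, show a / (1 + a) * ((1 + a) / a) = 1 by field_simp, Real.rpow_one]

lemma jump_rpow_of_le {a s : ℝ} (ha : 0 < a) (hs : 0 ≤ s) (hs' : s ≤ 1) :
    jump a (s ^ ((1 + a) / a)) = √(1 + a) / a * (s - 1) := by
  rw [jump_of_le a (Real.rpow_le_one hs hs' (by positivity)), rpow_rpow_acoustic ha hs]

lemma jump_rpow_of_ge {a s : ℝ} (ha : 0 < a) (hs : 1 ≤ s) :
    jump a (s ^ ((1 + a) / a)) = shockJump a (s ^ ((1 + a) / a)) :=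
  jump_of_ge a (Real.one_le_rpow hs (by positivity))

/-- The rarefaction and shock branches fit together to a differentiable curve. -/
lemma hasDerivAt_jump_rpow {a s : ℝ} (ha : 0 < a) (hs : 0 < s) :
    HasDerivAt (fun s : ℝ => jump a (s ^ ((1 + a) / a)))
      (shockSlope a (max s 1 ^ ((1 + a) / a))) s := by
  have hlin : ∀ t, HasDerivAt (fun s : ℝ => √(1 + a) / a * (s - 1)) (√(1 + a) / a) t := fun t => by
    simpa using ((hasDerivAt_id t).sub_const 1).const_mul (√(1 + a) / a)
  rcases lt_trichotomy s 1 with h | rfl | h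
  · rw [max_eq_right h.le, Real.one_rpow, shockSlope_one ha]
    refine (hlin s).congr_of_eventuallyEq ?_
    filter_upwards [Ioo_mem_nhds hs h] with t ht
    exact jump_rpow_of_le ha ht.1.le ht.2.le
  · rw [max_self, Real.one_rpow, shockSlope_one ha]
    have h1 : HasDerivWithinAt (fun s : ℝ => jump a (s ^ ((1 + a) / a))) (√(1 + a) / a)
        (Set.Iic 1) 1 := by
      refine (hlin 1).hasDerivWithinAt.congr_of_eventuallyEq ?_ (by simp)
      filter_upwards [self_mem_nhdsWithin, mem_nhdsWithin_of_mem_nhds (lt_mem_nhds hs)] with t ht ht0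
      exact jump_rpow_of_le ha ht0.le ht
    have h2 : HasDerivWithinAt (fun s : ℝ => jump a (s ^ ((1 + a) / a))) (√(1 + a) / a)
        (Set.Ici 1) 1 := by
      have h3 := hasDerivAt_shockJump_rpow ha one_pos
      rw [Real.one_rpow, shockSlope_one ha] at h3
      exact h3.hasDerivWithinAt.congr (fun t ht => jump_rpow_of_ge ha ht) (by simp)
    have := h1.union h2
    rwa [Set.Iic_union_Ici, hasDerivWithinAt_univ] at this
  · rw [max_eq_left h.le]
    refine (hasDerivAt_shockJump_rpow ha hs).congr_of_eventuallyEq ?_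
    filter_upwards [lt_mem_nhds h] with t ht
    exact jump_rpow_of_ge ha ht.le

lemma continuousOn_jump_rpow {a : ℝ} (ha : 0 < a) :
    ContinuousOn (fun s : ℝ => jump a (s ^ ((1 + a) / a))) (Set.Ici 0) := by
  intro s hs
  rcases (show 0 ≤ s from hs).eq_or_lt with rfl | h
  · have h1 : ContinuousWithinAt (fun s : ℝ => √(1 + a) / a * (s - 1)) (Set.Ici 0) 0 := by fun_prop
    refine h1.congr_of_eventuallyEq ?_ (jump_rpow_of_le ha le_rfl zero_le_one)
    filter_upwards [self_mem_nhdsWithin, mem_nhdsWithin_of_mem_nhds (gt_mem_nhds one_pos)]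
      with t ht ht'
    exact jump_rpow_of_le ha ht ht'.le
  · exact (hasDerivAt_jump_rpow ha h).continuousAt.continuousWithinAt

lemma convexOn_jump_rpow {a : ℝ} (ha : 0 < a) (ha' : a < 1 / 4) :
    ConvexOn ℝ (Set.Ici 0) (fun s : ℝ => jump a (s ^ ((1 + a) / a))) := by
  refine MonotoneOn.convexOn_of_deriv (convex_Ici 0) (continuousOn_jump_rpow ha) ?_ ?_
  · rw [interior_Ici]
    exact fun s hs => (hasDerivAt_jump_rpow ha hs).differentiableAt.differentiableWithinAt
  · rw [interior_Ici]
    intro s hs t ht hst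
    rw [(hasDerivAt_jump_rpow ha hs).deriv, (hasDerivAt_jump_rpow ha ht).deriv]
    have he : 0 ≤ (1 + a) / a := by positivity
    refine (strictMonoOn_shockSlope_Ici ha ha').monotoneOn
      (Real.one_le_rpow (le_max_right s 1) he) (Real.one_le_rpow (le_max_right t 1) he) ?_
    exact Real.rpow_le_rpow (by positivity) (max_le_max_right 1 hst) he

/-- A shock slows the gas down more than the continuation of the rarefaction curve would. -/
lemma lt_shockJump_rpow {a s : ℝ} (ha : 0 < a) (ha' : a < 1 / 4) (hs : 1 < s) :
    √(1 + a) / a * (s - 1) < shockJump a (s ^ ((1 + a) / a)) := by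
  have hd : ∀ t : ℝ, 0 < t → HasDerivAt
      (fun t : ℝ => shockJump a (t ^ ((1 + a) / a)) - √(1 + a) / a * (t - 1))
      (shockSlope a (t ^ ((1 + a) / a)) - √(1 + a) / a) t := fun t ht => by
    exact ((hasDerivAt_shockJump_rpow ha ht).sub
      (((hasDerivAt_id t).sub_const 1).const_mul (√(1 + a) / a))).congr_deriv (by simp)
  have hm : StrictMonoOn (fun t : ℝ => shockJump a (t ^ ((1 + a) / a)) - √(1 + a) / a * (t - 1))
      (Set.Ici 1) := by
    refine strictMonoOn_of_deriv_pos (convex_Ici 1) (fun t ht => ?_) fun t ht => ?_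
    · exact (hd t (lt_of_lt_of_le one_pos ht)).continuousAt.continuousWithinAt
    · rw [interior_Ici] at ht
      have ht : 1 < t := ht
      rw [(hd t (by linarith)).deriv, sub_pos, ← shockSlope_one ha]
      have h1 : 1 < t ^ ((1 + a) / a) := Real.one_lt_rpow ht (by positivity)
      exact strictMonoOn_shockSlope_Ici ha ha' (Set.self_mem_Ici) h1.le h1
  simpa using hm Set.self_mem_Ici hs.le hs

lemma lt_shockJump {a q : ℝ} (ha : 0 < a) (ha' : a < 1 / 4) (hq : 1 < q) :
    √(1 + a) / a * (q ^ (a / (1 + a)) - 1) < shockJump a q := by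
  have h := lt_shockJump_rpow ha ha' (Real.one_lt_rpow hq (z := a / (1 + a)) (by positivity))
  rwa [rpow_acoustic_rpow ha (by linarith)] at h

/-! ### Sign changes of convex functions -/

lemma _root_.ConvexOn.neg_of_mem_Ioo {f : ℝ → ℝ} {I : Set ℝ} (hf : ConvexOn ℝ I f) {x y z : ℝ}
    (hx : x ∈ I) (hz : z ∈ I) (hxy : x < y) (hyz : y < z) (hfx : f x ≤ 0) (hfz : f z ≤ 0)
    (h : f x < 0 ∨ f z < 0) : f y < 0 := by
  have h1 := hf.slope_mono_adjacent hx hz hxy hyz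
  rw [div_le_div_iff₀ (by linarith) (by linarith)] at h1
  have hA : 0 < z - y := by linarith
  have hB : 0 < y - x := by linarith
  by_contra! hy
  rcases h with h | h
  · nlinarith [mul_pos_of_neg_of_neg h (neg_neg_of_pos hA), mul_nonneg hy hA.le,
      mul_nonneg hy hB.le, mul_nonneg (neg_nonneg.2 hfz) hB.le]
  · nlinarith [mul_pos_of_neg_of_neg h (neg_neg_of_pos hB), mul_nonneg hy hA.le,
      mul_nonneg hy hB.le, mul_nonneg (neg_nonneg.2 hfx) hA.le]

/-- A convex function on `[0, b]` that is positive at `0`, negative at some `c` and not positive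
at `b` changes its sign exactly once before `b`. -/
lemma _root_.ConvexOn.exists_sign_change {f : ℝ → ℝ} {b c : ℝ} (hf : ConvexOn ℝ (Set.Icc 0 b) f)
    (hcont : ContinuousOn f (Set.Icc 0 b)) (h0 : 0 < f 0) (hc0 : 0 < c) (hcb : c ≤ b)
    (hc : f c < 0) (hb : f b ≤ 0) :
    ∃ r, 0 < r ∧ r < c ∧ f r = 0 ∧ (∀ s, 0 ≤ s → s < r → 0 < f s) ∧
      ∀ s, r < s → s < b → f s < 0 := by
  obtain ⟨r, hr, hfr⟩ := intermediate_value_Ioo' hc0.le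
    (hcont.mono (Set.Icc_subset_Icc_right hcb)) (show (0 : ℝ) ∈ Set.Ioo (f c) (f 0) from ⟨hc, h0⟩)
  have hcI : c ∈ Set.Icc 0 b := ⟨hc0.le, hcb⟩
  have hrI : r ∈ Set.Icc 0 b := ⟨hr.1.le, hr.2.le.trans hcb⟩
  refine ⟨r, hr.1, hr.2, hfr, fun s hs hsr => ?_, fun s hrs hsb => ?_⟩
  · by_contra! hfs
    have := hf.neg_of_mem_Ioo ⟨hs, hsr.le.trans hrI.2⟩ hcI hsr hr.2 hfs hc.le (Or.inr hc)
    exact this.ne hfr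
  · rcases lt_trichotomy s c with h | rfl | h
    · exact hf.neg_of_mem_Ioo hrI hcI hrs h hfr.le hc.le (Or.inr hc)
    · exact hc
    · exact hf.neg_of_mem_Ioo hcI ⟨hc0.le.trans hcb, le_rfl⟩ h hsb hc.le hb (Or.inl hc)

lemma _root_.HasDerivAt.exists_neg_of_pos {f : ℝ → ℝ} {d : ℝ} (hf : HasDerivAt f d 1)
    (hf1 : f 1 = 0) (hd : 0 < d) : ∃ c, f c < 0 ∧ 0 < c ∧ c < 1 := by
  have h1 := (hasDerivAt_iff_tendsto_slope.1 hf).mono_left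
    (nhdsWithin_mono 1 (show Set.Iio (1 : ℝ) ⊆ {1}ᶜ from fun s hs => ne_of_lt hs))
  obtain ⟨c, hc1, hc2, hc3⟩ := ((h1.eventually (lt_mem_nhds hd)).and
    (Filter.Eventually.and (self_mem_nhdsWithin (s := Set.Iio (1 : ℝ)))
      (mem_nhdsWithin_of_mem_nhds (lt_mem_nhds one_pos)))).exists
  rw [slope_def_field, hf1, sub_zero] at hc1
  have hc2 : c < 1 := hc2
  refine ⟨c, ?_, hc3, hc2⟩
  by_contra! hcc
  exact (div_nonpos_of_nonneg_of_nonpos hcc (by linarith)).not_gt hc1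

/-! ### The sign of the reflected wave -/

/-- The ratio of the values of `√(τ p)` on the two sides of a backward wave with pressure
ratio `q`. -/
noncomputable def acoustic (a q : ℝ) : ℝ :=
  if q ≤ 1 then q ^ (a / (1 + a)) else √(q * (1 + a * q) / (q + a))

lemma acoustic_of_le {q : ℝ} (a : ℝ) (hq : q ≤ 1) : acoustic a q = q ^ (a / (1 + a)) := if_pos hq

lemma acoustic_of_lt {q : ℝ} (a : ℝ) (hq : 1 < q) :
    acoustic a q = √(q * (1 + a * q) / (q + a)) := if_neg hq.not_ge

lemma acoustic_pos {a q : ℝ} (ha : 0 < a) (hq : 0 < q) : 0 < acoustic a q := by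
  unfold acoustic
  split_ifs <;> positivity

/-- The function `H`, divided by `κ`. -/
noncomputable def jumpDefect (a x y : ℝ) : ℝ := jump a (x * y) - jump a x - jump a y * acoustic a x

@[simp] lemma jumpDefect_one_right (a x : ℝ) : jumpDefect a x 1 = 0 := by simp [jumpDefect]

set_option maxRecDepth 20000 in
/-- After the substitution `x = 1 + X`, `y = 1 + Y`, `a = 1 / (4 + e)` both sides are polynomials
whose difference has no negative coefficient. -/
lemma overtaking_polynomial_ineq {a x y : ℝ} (ha : 0 < a) (ha' : a < 1 / 4) (hx : 1 < x)
    (hy : 1 ≤ y) :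
    (1 + a * x) * (y + 1 + 2 * a) ^ 2 * (x * y + a) ^ 3 <
      x * (x + a) * (x * y + 1 + 2 * a) ^ 2 * (y + a) ^ 3 := by
  obtain ⟨X, rfl⟩ : ∃ X, x = 1 + X := ⟨x - 1, by ring⟩
  obtain ⟨Y, rfl⟩ : ∃ Y, y = 1 + Y := ⟨y - 1, by ring⟩
  obtain ⟨e, he, rfl⟩ : ∃ e, 0 < e ∧ a = 1 / (4 + e) := by
    refine ⟨1 / a - 4, ?_, by simp⟩
    rw [sub_pos, lt_div_iff₀ ha]
    linarith
  have hX : 0 < X := by linarith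
  have hY : 0 ≤ Y := by linarith
  rw [← sub_pos]
  have h : 0 < (1 + X) * ((4 + e) * (1 + X) + 1) *
      ((4 + e) * (1 + X) * (1 + Y) + (4 + e) + 2) ^ 2 * ((4 + e) * (1 + Y) + 1) ^ 3 -
      ((4 + e) + (1 + X)) * ((4 + e) * (1 + Y) + (4 + e) + 2) ^ 2 *
        ((4 + e) * (1 + X) * (1 + Y) + 1) ^ 3 := by
    ring_nf
    positivity
  have h2 := div_pos h (show 0 < (4 + e) ^ 6 by positivity)
  have h3 : 4 + e ≠ 0 := by positivity
  refine h2.trans_eq ?_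
  field_simp

/-- `∂H/∂y > 0` for `1 < x` and `1 ≤ y`. -/
lemma shockJump_deriv_lt {a x y : ℝ} (ha : 0 < a) (ha' : a < 1 / 4) (hx : 1 < x) (hy : 1 ≤ y) :
    (y + 1 + 2 * a) / (2 * (y + a) * √(y + a)) * acoustic a x <
      x * ((x * y + 1 + 2 * a) / (2 * (x * y + a) * √(x * y + a))) := by
  have hx0 : 0 < x := by linarith
  have hy0 : 0 < y := by linarith
  rw [acoustic_of_lt a hx]
  have hs1 : √(y + a) ^ 2 = y + a := Real.sq_sqrt (by positivity)
  have hs2 : √(x * y + a) ^ 2 = x * y + a := Real.sq_sqrt (by positivity)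
  have hs3 : √(x * (1 + a * x) / (x + a)) ^ 2 = x * (1 + a * x) / (x + a) :=
    Real.sq_sqrt (by positivity)
  refine lt_of_pow_lt_pow_left₀ 2 (by positivity) ?_
  have e1 : ((y + 1 + 2 * a) / (2 * (y + a) * √(y + a)) * √(x * (1 + a * x) / (x + a))) ^ 2 =
      x * ((1 + a * x) * (y + 1 + 2 * a) ^ 2) / (4 * ((x + a) * (y + a) ^ 3)) := by
    rw [mul_pow, div_pow, mul_pow, hs1, hs3]
    field_simp
    ring
  have e2 : (x * ((x * y + 1 + 2 * a) / (2 * (x * y + a) * √(x * y + a)))) ^ 2 =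
      x * (x * (x * y + 1 + 2 * a) ^ 2) / (4 * (x * y + a) ^ 3) := by
    rw [mul_pow, div_pow, mul_pow, hs2]
    field_simp
    ring
  rw [e1, e2, div_lt_div_iff₀ (by positivity) (by positivity)]
  have := mul_lt_mul_of_pos_left (overtaking_polynomial_ineq ha ha' hx hy)
    (show 0 < 4 * x by positivity)
  linarith

lemma jumpDefect_pos_of_shock_shock {a x y : ℝ} (ha : 0 < a) (ha' : a < 1 / 4) (hx : 1 < x)
    (hy : 1 < y) : 0 < jumpDefect a x y := by
  have hx0 : 0 < x := by linarith
  have hd : ∀ t : ℝ, 1 ≤ t → HasDerivAt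
      (fun t : ℝ => shockJump a (x * t) - shockJump a x - shockJump a t * acoustic a x)
      (x * ((x * t + 1 + 2 * a) / (2 * (x * t + a) * √(x * t + a))) -
        (t + 1 + 2 * a) / (2 * (t + a) * √(t + a)) * acoustic a x) t := fun t ht => by
    have ht0 : 0 < t := by linarith
    have h1 := (hasDerivAt_shockJump (a := a) (q := x * t) (by positivity)).comp t
      ((hasDerivAt_id t).const_mul x)
    have h2 := (hasDerivAt_shockJump (a := a) (q := t) (by positivity)).mul_const (acoustic a x)
    exact ((h1.sub_const (shockJump a x)).sub h2).congr_deriv (by ring)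
  have hm : StrictMonoOn
      (fun t : ℝ => shockJump a (x * t) - shockJump a x - shockJump a t * acoustic a x)
      (Set.Ici 1) := by
    refine strictMonoOn_of_deriv_pos (convex_Ici 1)
      (fun t ht => (hd t ht).continuousAt.continuousWithinAt) fun t ht => ?_
    rw [interior_Ici] at ht
    have ht : 1 < t := ht
    rw [(hd t ht.le).deriv, sub_pos]
    exact shockJump_deriv_lt ha ha' hx ht.le
  have := hm Set.self_mem_Ici hy.le hy
  rw [jumpDefect, jump_of_ge a (by nlinarith), jump_of_ge a hx.le, jump_of_ge a hy.le]
  simpa using this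

/-- With `s` and `t` the acoustic variables of the two waves this is Jensen's inequality for the
convex wave curve at `s * t`, which lies between `1` and `t` if it exceeds `1`. -/
lemma jumpDefect_neg_of_rarefaction_shock {a x y : ℝ} (ha : 0 < a) (ha' : a < 1 / 4) (hx : 0 < x)
    (hx' : x < 1) (hy : 1 < y) : jumpDefect a x y < 0 := by
  obtain ⟨s, hs⟩ : ∃ s, s = x ^ (a / (1 + a)) := ⟨_, rfl⟩
  obtain ⟨t, ht⟩ : ∃ t, t = y ^ (a / (1 + a)) := ⟨_, rfl⟩
  have he : 0 < a / (1 + a) := by positivity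
  have hs0 : 0 < s := hs ▸ Real.rpow_pos_of_pos hx _
  have hs1 : s < 1 := hs ▸ Real.rpow_lt_one hx.le hx' he
  have ht1 : 1 < t := ht ▸ Real.one_lt_rpow hy he
  have hlt := lt_shockJump ha ha' hy
  rw [← ht, ← jump_of_ge a hy.le] at hlt
  have hst : s * t = (x * y) ^ (a / (1 + a)) := by
    rw [hs, ht, Real.mul_rpow hx.le (by linarith)]
  have hμ : 0 < √(1 + a) / a := by positivity
  rw [jumpDefect, jump_of_le a hx'.le, acoustic_of_le a hx'.le, ← hs]
  rcases le_or_gt (x * y) 1 with h | h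
  · rw [jump_of_le a h, ← hst]
    nlinarith [mul_pos hs0 (sub_pos.2 hlt)]
  · have hst1 : 1 < s * t := hst ▸ Real.one_lt_rpow h he
    have hst2 : s * t < t := by nlinarith
    have hc := (convexOn_jump_rpow ha ha').slope_mono_adjacent (x := 1) (y := s * t) (z := t)
      (by simp) (by simp only [Set.mem_Ici]; linarith) hst1 hst2
    simp only [Real.one_rpow, jump_one] at hc
    rw [hst, rpow_acoustic_rpow ha (by positivity), ← hst, ht, rpow_acoustic_rpow ha (by linarith),
      ← ht, div_le_div_iff₀ (by linarith) (by linarith)] at hc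
    -- the slope inequality reads `jump (x * y) * (t - 1) ≤ jump y * (s * t - 1)`
    have h1 : (jump a (x * y) - √(1 + a) / a * (s - 1) - jump a y * s) * (t - 1) < 0 := by
      nlinarith [mul_pos (sub_pos.2 hs1) (sub_pos.2 hlt)]
    exact neg_of_mul_neg_left h1 (by linarith)

/-- `H` is positive at `y = 0`. By the inequality between arithmetic and quadratic mean the claim
reduces to `(1 - a) * (x - 1) ^ 2 > 0`. -/
lemma shockJump_lt_acoustic_sub_one {a x : ℝ} (ha : 0 < a) (ha' : a < 1 / 4) (hx : 1 < x) :
    shockJump a x < √(1 + a) / a * (acoustic a x - 1) := by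
  have hx0 : 0 < x := by linarith
  rw [acoustic_of_lt a hx, shockJump, Real.sqrt_div (by positivity)]
  obtain ⟨A, hA⟩ : ∃ A, A = √(x * (1 + a * x)) := ⟨_, rfl⟩
  obtain ⟨B, hB⟩ : ∃ B, B = √(x + a) := ⟨_, rfl⟩
  obtain ⟨C, hC⟩ : ∃ C, C = √(1 + a) := ⟨_, rfl⟩
  have hA2 : A ^ 2 = x * (1 + a * x) := hA ▸ Real.sq_sqrt (by positivity)
  have hB2 : B ^ 2 = x + a := hB ▸ Real.sq_sqrt (by positivity)
  have hC2 : C ^ 2 = 1 + a := hC ▸ Real.sq_sqrt (by positivity)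
  have hA0 : 0 < A := hA ▸ Real.sqrt_pos.2 (by positivity)
  have hB0 : 0 < B := hB ▸ Real.sqrt_pos.2 (by positivity)
  have hC0 : 0 < C := hC ▸ Real.sqrt_pos.2 (by positivity)
  rw [← hA, ← hB, ← hC]
  have hAB : A + B < C * (x + 1) := by
    refine lt_of_pow_lt_pow_left₀ 2 (by positivity) ?_
    rw [mul_pow, hC2]
    have : 0 < (1 - a) * (x - 1) ^ 2 := mul_pos (by linarith) (by nlinarith)
    nlinarith [sq_nonneg (A - B)]
  have h1 : C / a * (A / B - 1) = C * (x ^ 2 - 1) / (B * (A + B)) := by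
    have h2 : A ^ 2 - B ^ 2 = a * (x ^ 2 - 1) := by rw [hA2, hB2]; ring
    field_simp
    linear_combination h2
  rw [h1, div_lt_div_iff₀ hB0 (by positivity)]
  nlinarith [mul_pos (mul_pos hB0 (sub_pos.2 hx)) (sub_pos.2 hAB)]

/-- In the acoustic variable `s` of the rarefaction, `H` is convex on `[0, 1]`, positive at `0`,
and reaches its zero at `s = 1` with a positive slope. -/
lemma exists_jumpDefect_sign {a x : ℝ} (ha : 0 < a) (ha' : a < 1 / 4) (hx : 1 < x) :
    ∃ r, 0 < r ∧ r < 1 ∧ jumpDefect a x r = 0 ∧ (∀ y, 0 < y → y < r → 0 < jumpDefect a x y) ∧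
      ∀ y, r < y → y < 1 → jumpDefect a x y < 0 := by
  have hx0 : 0 < x := by linarith
  have he : 0 < a / (1 + a) := by positivity
  have he' : 0 < (1 + a) / a := by positivity
  obtain ⟨X, hX⟩ : ∃ X, X = x ^ (a / (1 + a)) := ⟨_, rfl⟩
  have hX1 : 1 < X := hX ▸ Real.one_lt_rpow hx he
  have hX0 : 0 < X := by linarith
  have hXx : X ^ ((1 + a) / a) = x := by rw [hX, rpow_acoustic_rpow ha hx0.le]
  set f : ℝ → ℝ := fun s => jump a ((X * s) ^ ((1 + a) / a)) - shockJump a x -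
    √(1 + a) / a * (s - 1) * acoustic a x with hf
  have hfH : ∀ s, 0 ≤ s → s ≤ 1 → f s = jumpDefect a x (s ^ ((1 + a) / a)) := fun s hs hs' => by
    simp only [hf]
    rw [jumpDefect, jump_rpow_of_le ha hs hs', Real.mul_rpow hX0.le hs, hXx, jump_of_ge a hx.le]
  have hcv : ConvexOn ℝ (Set.Icc 0 1) f := by
    have h1 : ConvexOn ℝ (Set.Icc (0 : ℝ) 1) fun s => jump a ((X * s) ^ ((1 + a) / a)) := by
      refine ⟨convex_Icc _ _, fun s hs t ht p q hp hq hpq => ?_⟩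
      have := (convexOn_jump_rpow ha ha').2 (mul_nonneg hX0.le hs.1 : X * s ∈ Set.Ici 0)
        (mul_nonneg hX0.le ht.1 : X * t ∈ Set.Ici 0) hp hq hpq
      simp only [smul_eq_mul] at this ⊢
      rwa [show X * (p * s + q * t) = p * (X * s) + q * (X * t) by ring]
    refine ⟨convex_Icc _ _, fun s hs t ht p q hp hq hpq => ?_⟩
    have h2 := h1.2 hs ht hp hq hpq
    simp only [smul_eq_mul, hf] at h2 ⊢
    obtain rfl : q = 1 - p := by linarith
    linarith
  have hct : ContinuousOn f (Set.Icc 0 1) := by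
    have h1 : ContinuousOn (fun s : ℝ => jump a ((X * s) ^ ((1 + a) / a))) (Set.Icc 0 1) :=
      (continuousOn_jump_rpow ha).comp (by fun_prop) fun s hs => mul_nonneg hX0.le hs.1
    exact (h1.sub continuousOn_const).sub (by fun_prop)
  have hf0 : 0 < f 0 := by
    have h1 : jump a ((X * 0) ^ ((1 + a) / a)) = - (√(1 + a) / a) := by
      rw [mul_zero, jump_rpow_of_le ha le_rfl zero_le_one]; ring
    simp only [hf, h1]
    linarith [shockJump_lt_acoustic_sub_one ha ha' hx]
  have hf1 : f 1 = 0 := by rw [hfH 1 zero_le_one le_rfl]; simp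
  have hfd : HasDerivAt f (shockSlope a x * X - √(1 + a) / a * acoustic a x) 1 := by
    have h1 := (hasDerivAt_jump_rpow (s := X * 1) ha (by simpa using hX0)).comp 1
      ((hasDerivAt_id (1 : ℝ)).const_mul X)
    have h2 := (((hasDerivAt_id (1 : ℝ)).sub_const 1).const_mul (√(1 + a) / a)).mul_const
      (acoustic a x)
    refine ((h1.sub_const (shockJump a x)).sub h2).congr_deriv ?_
    rw [mul_one, max_eq_left hX1.le, hXx]
    ring
  -- this is `∂H/∂y > 0` at `y = 1`, rewritten in the acoustic variable
  have hslope : 0 < shockSlope a x * X - √(1 + a) / a * acoustic a x := by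
    have h1 := shockJump_deriv_lt ha ha' hx le_rfl
    have h2 : shockSlope a x * X = (1 + a) / a * (x * ((x * 1 + 1 + 2 * a) /
        (2 * (x * 1 + a) * √(x * 1 + a)))) := by
      have h3 : x ^ (1 / (1 + a)) * X = x := by
        rw [hX, ← Real.rpow_add hx0, show 1 / (1 + a) + a / (1 + a) = 1 by field_simp,
          Real.rpow_one]
      rw [shockSlope, mul_one]
      linear_combination (x + 1 + 2 * a) / (2 * (x + a) * √(x + a)) * ((1 + a) / a) * h3
    have h4 : √(1 + a) / a = (1 + a) / a * ((1 + 1 + 2 * a) / (2 * (1 + a) * √(1 + a))) := by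
      have h5 : √(1 + a) ^ 2 = 1 + a := Real.sq_sqrt (by positivity)
      field_simp
      rw [h5]
      ring
    rw [h2, h4]
    have h6 := mul_lt_mul_of_pos_left h1 he'
    linarith
  obtain ⟨c, hc, hc0, hc1⟩ := hfd.exists_neg_of_pos hf1 hslope
  obtain ⟨r, hr0, hrc, hr, hpos, hneg⟩ := hcv.exists_sign_change hct hf0 hc0 hc1.le hc hf1.le
  have hrep : ∀ y, 0 < y → y < 1 → jumpDefect a x y = f (y ^ (a / (1 + a))) := fun y hy hy' => by
    rw [hfH _ (Real.rpow_nonneg hy.le _) (Real.rpow_le_one hy.le hy'.le he.le),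
      rpow_acoustic_rpow ha hy.le]
  have hrr := rpow_rpow_acoustic ha hr0.le
  have hr1 : r ^ ((1 + a) / a) < 1 := Real.rpow_lt_one hr0.le (hrc.trans hc1) he'
  have hr2 : 0 < r ^ ((1 + a) / a) := Real.rpow_pos_of_pos hr0 _
  refine ⟨r ^ ((1 + a) / a), hr2, hr1, ?_, fun y hy hyr => ?_, fun y hry hy => ?_⟩
  · rw [hrep _ hr2 hr1, hrr, hr]
  · rw [hrep y hy (hyr.trans hr1)]
    refine hpos _ (Real.rpow_nonneg hy.le _) ?_
    exact hrr ▸ Real.rpow_lt_rpow hy.le hyr he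
  · rw [hrep y (hr2.trans hry) hy]
    refine hneg _ ?_ (Real.rpow_lt_one (hr2.trans hry).le hy he)
    exact hrr ▸ Real.rpow_lt_rpow hr2.le hry he

/-! ### The crossing of the shock curve and the rarefaction curve -/

lemma neg_rareSlope_lt_shockJump_zero {a : ℝ} (ha : 0 < a) : -(√(1 + a) / a) < shockJump a 0 := by
  have h1 : 0 < √a := Real.sqrt_pos.2 ha
  have h2 : √a < √(1 + a) := Real.sqrt_lt_sqrt ha.le (by linarith)
  have h3 : √a * √a = a := Real.mul_self_sqrt ha.le
  rw [shockJump, zero_sub, zero_add, neg_div, neg_lt_neg_iff, div_lt_div_iff₀ h1 ha]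
  nlinarith

/-- Below pressure ratio `1` the Hugoniot curve crosses the rarefaction curve exactly once: their
difference is convex in the acoustic variable up to the inflection point, and increases to `0`
from there on. -/
lemma exists_shock_rarefaction_crossing {a : ℝ} (ha : 0 < a) (ha' : a < 1 / 4) :
    ∃ r, 0 < r ∧ r < 1 ∧ shockJump a r - √(1 + a) / a * (r ^ (a / (1 + a)) - 1) = 0 ∧
      (∀ q, 0 < q → q < r → 0 < shockJump a q - √(1 + a) / a * (q ^ (a / (1 + a)) - 1)) ∧
      ∀ q, r < q → q < 1 → shockJump a q - √(1 + a) / a * (q ^ (a / (1 + a)) - 1) < 0 := by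
  have he : 0 < a / (1 + a) := by positivity
  have he' : 0 < (1 + a) / a := by positivity
  have hi0 := inflection_pos ha ha'
  have hi1 := inflection_lt_one ha ha'
  set f : ℝ → ℝ := fun s => shockJump a (s ^ ((1 + a) / a)) - √(1 + a) / a * (s - 1) with hf
  have hd : ∀ s : ℝ, 0 < s → HasDerivAt f
      (shockSlope a (s ^ ((1 + a) / a)) - √(1 + a) / a) s := fun s hs =>
    ((hasDerivAt_shockJump_rpow ha hs).sub
      (((hasDerivAt_id s).sub_const 1).const_mul (√(1 + a) / a))).congr_deriv (by simp)
  have hct : ContinuousOn f (Set.Ici 0) := by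
    have h1 : ContinuousOn (fun s : ℝ => shockJump a (s ^ ((1 + a) / a))) (Set.Ici 0) :=
      (continuousOn_shockJump ha).comp
        (Real.continuous_rpow_const he'.le).continuousOn fun s hs => Real.rpow_nonneg hs _
    exact h1.sub (by fun_prop)
  obtain ⟨c, hc⟩ : ∃ c, c = inflection a ^ (a / (1 + a)) := ⟨_, rfl⟩
  have hc0 : 0 < c := hc ▸ Real.rpow_pos_of_pos hi0 _
  have hc1 : c < 1 := hc ▸ Real.rpow_lt_one hi0.le hi1 he
  have hci : c ^ ((1 + a) / a) = inflection a := by rw [hc, rpow_acoustic_rpow ha hi0.le]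
  have hneg1 : ∀ s, c ≤ s → s < 1 → f s < 0 := by
    have hm : StrictMonoOn f (Set.Icc c 1) := by
      refine strictMonoOn_of_deriv_pos (convex_Icc _ _)
        (hct.mono fun s hs => hc0.le.trans hs.1) fun s hs => ?_
      rw [interior_Icc] at hs
      have hs0 : 0 < s := hc0.trans hs.1
      rw [(hd s hs0).deriv, sub_pos, ← shockSlope_one ha]
      have h1 : s ^ ((1 + a) / a) < 1 := Real.rpow_lt_one hs0.le hs.2 he'
      refine strictAntiOn_shockSlope_Icc ha ha' ⟨?_, h1.le⟩ ⟨hi1.le, le_rfl⟩ h1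
      exact hci ▸ Real.rpow_le_rpow hc0.le hs.1.le he'.le
    intro s hcs hs1
    have h1 : f 1 = 0 := by simp [hf]
    exact h1 ▸ hm ⟨hcs, hs1.le⟩ ⟨hc1.le, le_rfl⟩ hs1
  have hcv : ConvexOn ℝ (Set.Icc 0 c) f := by
    refine MonotoneOn.convexOn_of_deriv (convex_Icc 0 c) (hct.mono Set.Icc_subset_Ici_self) ?_ ?_
    · rw [interior_Icc]
      exact fun s hs => (hd s hs.1).differentiableAt.differentiableWithinAt
    · rw [interior_Icc]
      intro s hs t ht hst
      rw [(hd s hs.1).deriv, (hd t ht.1).deriv]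
      have h1 : ∀ u ∈ Set.Ioo 0 c, u ^ ((1 + a) / a) ∈ Set.Ioc 0 (inflection a) := fun u hu =>
        ⟨Real.rpow_pos_of_pos hu.1 _, hci ▸ Real.rpow_le_rpow hu.1.le hu.2.le he'.le⟩
      exact sub_le_sub_right ((strictMonoOn_shockSlope_Ioc ha ha').monotoneOn (h1 s hs) (h1 t ht)
        (Real.rpow_le_rpow hs.1.le hst he'.le)) _
  have hf0 : 0 < f 0 := by
    simp only [hf, Real.zero_rpow he'.ne']
    linarith [neg_rareSlope_lt_shockJump_zero ha]
  have hfc := hneg1 c le_rfl hc1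
  obtain ⟨r, hr0, hrc, hr, hpos, hneg⟩ :=
    hcv.exists_sign_change (hct.mono Set.Icc_subset_Ici_self) hf0 hc0 le_rfl hfc hfc.le
  have hrep : ∀ q, 0 < q → shockJump a q - √(1 + a) / a * (q ^ (a / (1 + a)) - 1) =
      f (q ^ (a / (1 + a))) := fun q hq => by
    simp only [hf, rpow_acoustic_rpow ha hq.le]
  have hrr := rpow_rpow_acoustic ha hr0.le
  have hr2 : 0 < r ^ ((1 + a) / a) := Real.rpow_pos_of_pos hr0 _
  refine ⟨r ^ ((1 + a) / a), hr2, Real.rpow_lt_one hr0.le (hrc.trans hc1) he', ?_,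
    fun q hq hqr => ?_, fun q hrq hq => ?_⟩
  · rw [hrep _ hr2, hrr, hr]
  · rw [hrep q hq]
    refine hpos _ (Real.rpow_nonneg hq.le _) ?_
    exact hrr ▸ Real.rpow_lt_rpow hq.le hqr he
  · have hq0 := hr2.trans hrq
    rw [hrep q hq0]
    have h1 : r < q ^ (a / (1 + a)) := hrr ▸ Real.rpow_lt_rpow hr2.le hrq he
    rcases lt_or_ge (q ^ (a / (1 + a))) c with h | h
    · exact hneg _ h1 h
    · exact hneg1 _ h (Real.rpow_lt_one hq0.le hq he)

/-! ### The sign of the transmitted wave -/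

lemma continuousOn_jump {a : ℝ} (ha : 0 < a) : ContinuousOn (jump a) (Set.Ici 0) := by
  have h1 : ContinuousOn (fun q : ℝ => jump a ((q ^ (a / (1 + a))) ^ ((1 + a) / a))) (Set.Ici 0) :=
    (continuousOn_jump_rpow ha).comp
      (Real.continuous_rpow_const (by positivity)).continuousOn fun q hq => Real.rpow_nonneg hq _
  exact h1.congr fun q hq => by simp only [rpow_acoustic_rpow ha (show 0 ≤ q from hq)]

lemma strictMonoOn_jump {a : ℝ} (ha : 0 < a) : StrictMonoOn (jump a) (Set.Ici 0) := by
  have h1 : StrictMonoOn (jump a) (Set.Icc 0 1) := by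
    intro q hq r hr hqr
    rw [jump_of_le a hq.2, jump_of_le a hr.2]
    have := Real.rpow_lt_rpow hq.1 hqr (show 0 < a / (1 + a) by positivity)
    exact mul_lt_mul_of_pos_left (by linarith) (by positivity)
  have h2 : StrictMonoOn (jump a) (Set.Ici 1) := by
    intro q hq r hr hqr
    rw [jump_of_ge a hq, jump_of_ge a hr]
    exact strictMonoOn_shockJump ha (Set.Ici_subset_Ici.2 zero_le_one hq)
      (Set.Ici_subset_Ici.2 zero_le_one hr) hqr
  have h3 := h1.union h2 ⟨⟨zero_le_one, le_rfl⟩, fun q hq => hq.2⟩ ⟨Set.self_mem_Ici, fun q hq => hq⟩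
  rwa [Set.Icc_union_Ici_eq_Ici zero_le_one] at h3

/-- In the acoustic variable the quotient is a secant slope of the convex wave curve, taken from
the vacuum, minus a multiple of `1 / s`. -/
lemma jump_sub_div_lt {a q r : ℝ} (ha : 0 < a) (ha' : a < 1 / 4) (hq : 0 < q) (hqr : q < r) :
    (jump a q - √(1 + a) / a) / q ^ (a / (1 + a)) <
      (jump a r - √(1 + a) / a) / r ^ (a / (1 + a)) := by
  have he : 0 < a / (1 + a) := by positivity
  have hs : 0 < q ^ (a / (1 + a)) := Real.rpow_pos_of_pos hq _
  have hst : q ^ (a / (1 + a)) < r ^ (a / (1 + a)) := Real.rpow_lt_rpow hq.le hqr he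
  have ht := hs.trans hst
  have hc := (convexOn_jump_rpow ha ha').secant_mono Set.self_mem_Ici hs.le ht.le hs.ne' ht.ne'
    hst.le
  simp only [rpow_acoustic_rpow ha hq.le, rpow_acoustic_rpow ha (hq.trans hqr).le, sub_zero,
    jump_rpow_of_le ha le_rfl zero_le_one] at hc
  have h1 : 2 * (√(1 + a) / a) / r ^ (a / (1 + a)) < 2 * (√(1 + a) / a) / q ^ (a / (1 + a)) :=
    div_lt_div_of_pos_left (by positivity) hs hst
  have h2 : ∀ u v : ℝ, (u - √(1 + a) / a) / v =
      (u - √(1 + a) / a * (0 - 1)) / v - 2 * (√(1 + a) / a) / v := fun u v => by ring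
  rw [h2, h2 (jump a r)]
  linarith

/-- The velocity defect of the wave fan whose backward wave has strength `1`, in the interaction
of a shock of strength `x` with a rarefaction of strength `y`, divided by `κ` and by
`acoustic a x`. -/
noncomputable def transmittedDefect (a x y : ℝ) : ℝ :=
  acoustic a y * jump a (x * y)⁻¹ - jump a y + shockJump a x⁻¹

lemma transmittedDefect_eq {a x y : ℝ} (hx : 0 < x) (hy : 0 < y) (hy' : y ≤ 1) :
    transmittedDefect a x y = (jump a (x * y)⁻¹ - √(1 + a) / a) / (x * y)⁻¹ ^ (a / (1 + a)) *
      x⁻¹ ^ (a / (1 + a)) + √(1 + a) / a + shockJump a x⁻¹ := by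
  have h1 : 0 < x ^ (a / (1 + a)) := Real.rpow_pos_of_pos hx _
  have h2 : 0 < y ^ (a / (1 + a)) := Real.rpow_pos_of_pos hy _
  rw [transmittedDefect, acoustic_of_le a hy', jump_of_le a hy', Real.inv_rpow hx.le,
    Real.inv_rpow (by positivity), Real.mul_rpow hx.le hy.le]
  field_simp
  ring

lemma transmittedDefect_strictAntiOn {a x : ℝ} (ha : 0 < a) (ha' : a < 1 / 4) (hx : 0 < x) :
    StrictAntiOn (transmittedDefect a x) (Set.Ioc 0 1) := by
  intro y hy z hz hyz
  rw [transmittedDefect_eq hx hy.1 hy.2, transmittedDefect_eq hx hz.1 hz.2]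
  have h1 : (x * z)⁻¹ < (x * y)⁻¹ :=
    inv_strictAnti₀ (mul_pos hx hy.1) (mul_lt_mul_of_pos_left hyz hx)
  have h2 := jump_sub_div_lt ha ha' (inv_pos.2 (mul_pos hx hz.1)) h1
  have h3 : 0 < x⁻¹ ^ (a / (1 + a)) := Real.rpow_pos_of_pos (inv_pos.2 hx) _
  linarith [mul_lt_mul_of_pos_right h2 h3]

lemma exists_transmittedDefect_eq_zero {a x : ℝ} (ha : 0 < a) (hx : 1 < x) :
    ∃ r, 0 < r ∧ r < 1 ∧ transmittedDefect a x r = 0 := by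
  have hx0 : 0 < x := by linarith
  have he : 0 < a / (1 + a) := by positivity
  have hx1 : x⁻¹ < 1 := inv_lt_one_of_one_lt₀ hx
  have hxi : 0 < x⁻¹ := inv_pos.2 hx0
  have hμ : 0 < √(1 + a) / a := by positivity
  -- a value of `y` at which the defect is positive, found close to `0`
  obtain ⟨ε, hε0, hεx, hε⟩ : ∃ ε, 0 < ε ∧ ε < x⁻¹ ∧ 0 < transmittedDefect a x ε := by
    have hδ : 0 < √(1 + a) / a + shockJump a x⁻¹ := by
      linarith [neg_rareSlope_lt_shockJump_zero ha,
        strictMonoOn_shockJump ha Set.self_mem_Ici hxi.le hxi]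
    have h1 : Filter.Tendsto (fun y : ℝ => √(1 + a) / a * y ^ (a / (1 + a))) (𝓝[>] 0) (𝓝 0) := by
      have : ContinuousAt (fun y : ℝ => √(1 + a) / a * y ^ (a / (1 + a))) 0 :=
        continuousAt_const.mul (Real.continuousAt_rpow_const 0 _ (Or.inr he.le))
      have h2 := this.tendsto.mono_left (nhdsWithin_le_nhds (s := Set.Ioi 0))
      simpa [Real.zero_rpow he.ne'] using h2
    obtain ⟨ε, h2, h3, h4⟩ := ((h1.eventually (gt_mem_nhds hδ)).and
      (Filter.Eventually.and (self_mem_nhdsWithin (s := Set.Ioi (0 : ℝ)))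
        (mem_nhdsWithin_of_mem_nhds (gt_mem_nhds hxi)))).exists
    have h3 : 0 < ε := h3
    refine ⟨ε, h3, h4, ?_⟩
    have h5 : 0 ≤ jump a (x * ε)⁻¹ := by
      have h6 : 1 ≤ (x * ε)⁻¹ := by
        refine (one_le_inv₀ (by positivity)).2 ?_
        have := mul_lt_mul_of_pos_left h4 hx0
        rw [mul_inv_cancel₀ hx0.ne'] at this
        exact this.le
      simpa using (strictMonoOn_jump ha).monotoneOn (Set.mem_Ici.2 zero_le_one)
        (Set.mem_Ici.2 (zero_le_one.trans h6)) h6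
    rw [transmittedDefect, jump_of_le a (h4.trans hx1).le]
    nlinarith [mul_nonneg (acoustic_pos ha h3).le h5]
  have h1 : transmittedDefect a x 1 < 0 := by
    have h2 := strictMonoOn_jump ha hxi.le (Set.mem_Ici.2 zero_le_one) hx1
    have h3 := strictMonoOn_shockJump ha hxi.le (Set.mem_Ici.2 zero_le_one) hx1
    rw [jump_one] at h2
    rw [shockJump_one] at h3
    have : acoustic a 1 = 1 := by simp [acoustic]
    simp only [transmittedDefect, this, mul_one, one_mul, jump_one]
    linarith
  have hct : ContinuousOn (transmittedDefect a x) (Set.Icc ε 1) := by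
    have hp : ContinuousOn (fun y : ℝ => y ^ (a / (1 + a))) (Set.Icc ε 1) :=
      (Real.continuous_rpow_const he.le).continuousOn
    have hj : ContinuousOn (fun y : ℝ => jump a (x * y)⁻¹) (Set.Icc ε 1) := by
      refine (continuousOn_jump ha).comp (ContinuousOn.inv₀ (by fun_prop) fun y hy => ?_)
        fun y hy => ?_
      · exact (mul_pos hx0 (hε0.trans_le hy.1)).ne'
      · exact inv_nonneg.2 (mul_pos hx0 (hε0.trans_le hy.1)).le
    have : ContinuousOn (fun y : ℝ => y ^ (a / (1 + a)) * jump a (x * y)⁻¹ -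
        √(1 + a) / a * (y ^ (a / (1 + a)) - 1) + shockJump a x⁻¹) (Set.Icc ε 1) :=
      ((hp.mul hj).sub (continuousOn_const.mul (hp.sub continuousOn_const))).add continuousOn_const
    refine this.congr fun y hy => ?_
    rw [transmittedDefect, acoustic_of_le a hy.2, jump_of_le a hy.2]
  obtain ⟨r, hr, hr0⟩ := intermediate_value_Ioo' (hεx.trans hx1).le hct ⟨h1, hε⟩
  exact ⟨r, hε0.trans hr.1, hr.2, hr0⟩

/-! ### Strong shocks -/

/-- The function `s ^ p - 1 - (s - 1) / w` with `p = 1 / (2 w²)` changes its sign once before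
`s = 1`, where it vanishes with positive slope because `w < 1 / 2`. -/
lemma exists_power_crossing {w : ℝ} (hw : 0 < w) (hw' : w < 1 / 2) :
    ∃ r : ℝ, (1 - w) / 2 < r ∧ r < 1 ∧
      (∀ s : ℝ, 0 ≤ s → s < r → 0 < s ^ (1 / (2 * w ^ 2)) - 1 - (s - 1) / w) ∧
      ∀ s : ℝ, r < s → s < 1 → s ^ (1 / (2 * w ^ 2)) - 1 - (s - 1) / w < 0 := by
  have hp : 1 ≤ 1 / (2 * w ^ 2) := by
    rw [le_div_iff₀ (by positivity)]
    nlinarith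
  have hp0 : 1 / (2 * w ^ 2) ≠ 0 := by positivity
  set f : ℝ → ℝ := fun s => s ^ (1 / (2 * w ^ 2)) - 1 - (s - 1) / w with hf
  have hcv : ConvexOn ℝ (Set.Icc 0 1) f := by
    have h1 := (convexOn_rpow hp).subset Set.Icc_subset_Ici_self (convex_Icc (0 : ℝ) 1)
    refine ⟨convex_Icc _ _, fun s hs t ht p q hp hq hpq => ?_⟩
    have h2 := h1.2 hs ht hp hq hpq
    simp only [smul_eq_mul, hf] at h2 ⊢
    obtain rfl : q = 1 - p := by linarith
    have h3 : (p * s + (1 - p) * t - 1) / w = p * ((s - 1) / w) + (1 - p) * ((t - 1) / w) := by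
      ring
    rw [h3]
    linarith
  have hct : ContinuousOn f (Set.Icc 0 1) := by
    have := (Real.continuous_rpow_const (zero_le_one.trans hp)).continuousOn (s := Set.Icc 0 1)
    exact (this.sub continuousOn_const).sub (by fun_prop)
  have hf1 : f 1 = 0 := by simp [hf]
  have hf0 : 0 < f 0 := by
    have : 1 < 1 / w := by rw [lt_div_iff₀ hw]; linarith
    simp only [hf, Real.zero_rpow hp0, zero_sub, neg_div]
    linarith
  have hfd : HasDerivAt f (1 / (2 * w ^ 2) - 1 / w) 1 := by
    have h1 := Real.hasDerivAt_rpow_const (x := 1) (p := 1 / (2 * w ^ 2)) (Or.inl one_ne_zero)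
    refine ((h1.sub_const 1).sub (((hasDerivAt_id 1).sub_const 1).div_const w)).congr_deriv ?_
    simp
  have hslope : 0 < 1 / (2 * w ^ 2) - 1 / w := by
    rw [sub_pos, div_lt_div_iff₀ hw (by positivity)]
    nlinarith
  obtain ⟨c, hc, hc0, hc1⟩ := hfd.exists_neg_of_pos hf1 hslope
  obtain ⟨r, hr0, hrc, hr, hpos, hneg⟩ := hcv.exists_sign_change hct hf0 hc0 hc1.le hc hf1.le
  refine ⟨r, ?_, hrc.trans hc1, hpos, hneg⟩
  by_contra! h
  have h1 : 0 < f ((1 - w) / 2) := by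
    have h2 : f ((1 - w) / 2) = ((1 - w) / 2) ^ (1 / (2 * w ^ 2)) + (1 / w - 1) / 2 := by
      simp only [hf]
      field_simp
      ring
    have h3 : 1 < 1 / w := by rw [lt_div_iff₀ hw]; linarith
    have h4 : 0 ≤ ((1 - w) / 2) ^ (1 / (2 * w ^ 2)) := Real.rpow_nonneg (by linarith) _
    rw [h2]
    linarith
  rcases h.eq_or_lt with h | h
  · exact h1.ne' (h ▸ hr)
  · exact (hneg _ h (by linarith)).not_gt h1

/-- The limit of `H(x, y) / (κ √x)` for an infinitely strong shock. -/
noncomputable def strongShockDefect (a y : ℝ) : ℝ :=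
  √y - 1 - √(1 + a) / a * (y ^ (a / (1 + a)) - 1) * √a

lemma exists_strongShockDefect_sign {a : ℝ} (ha : 0 < a) (ha' : a < 1 / 4) :
    ∃ r : ℝ, ((1 - √(a / (1 + a))) / 2) ^ ((1 + a) / a) < r ∧ r < 1 ∧
      (∀ y, 0 < y → y < r → 0 < strongShockDefect a y) ∧
      ∀ y, r < y → y < 1 → strongShockDefect a y < 0 := by
  have he : 0 < a / (1 + a) := by positivity
  have he' : 0 < (1 + a) / a := by positivity
  obtain ⟨w, hw⟩ : ∃ w, w = √(a / (1 + a)) := ⟨_, rfl⟩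
  have hw0 : 0 < w := hw ▸ Real.sqrt_pos.2 he
  have hw2 : w ^ 2 = a / (1 + a) := hw ▸ Real.sq_sqrt he.le
  have hw1 : w < 1 / 2 := by
    refine lt_of_pow_lt_pow_left₀ 2 (by norm_num) ?_
    rw [hw2, div_lt_iff₀ (by positivity)]
    linarith
  obtain ⟨r, hr0, hr1, hpos, hneg⟩ := exists_power_crossing hw0 hw1
  have hr : 0 < r := lt_trans (by linarith) hr0
  have hrep : ∀ y, 0 < y → strongShockDefect a y = (y ^ (a / (1 + a))) ^ (1 / (2 * w ^ 2)) - 1 -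
      (y ^ (a / (1 + a)) - 1) / w := fun y hy => by
    have h1 : √(1 + a) / a * √a = 1 / w := by
      rw [hw, Real.sqrt_div ha.le, one_div_div, div_mul_eq_mul_div,
        div_eq_div_iff ha.ne' (Real.sqrt_pos.2 ha).ne', mul_assoc, Real.mul_self_sqrt ha.le]
    have h2 : (y ^ (a / (1 + a))) ^ (1 / (2 * w ^ 2)) = √y := by
      rw [hw2, ← Real.rpow_mul hy.le, Real.sqrt_eq_rpow]
      congr 1
      field_simp
    rw [strongShockDefect, h2]
    linear_combination (1 - y ^ (a / (1 + a))) * h1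
  have hrr := rpow_rpow_acoustic ha hr.le
  refine ⟨r ^ ((1 + a) / a), ?_, Real.rpow_lt_one hr.le hr1 he', fun y hy hyr => ?_,
    fun y hry hy => ?_⟩
  · rw [← hw]
    exact Real.rpow_lt_rpow (by linarith) hr0 he'
  · rw [hrep y hy]
    exact hpos _ (Real.rpow_nonneg hy.le _) (hrr ▸ Real.rpow_lt_rpow hy.le hyr he)
  · have hr2 := Real.rpow_pos_of_pos hr ((1 + a) / a)
    rw [hrep y (hr2.trans hry)]
    exact hneg _ (hrr ▸ Real.rpow_lt_rpow hr2.le hry he)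
      (Real.rpow_lt_one (hr2.trans hry).le hy he)

lemma tendsto_jumpDefect_div_sqrt {a y : ℝ} (ha : 0 < a) (hy : 0 < y) (hy' : y < 1) :
    Filter.Tendsto (fun x => jumpDefect a x y / √x) Filter.atTop (𝓝 (strongShockDefect a y)) := by
  set g : ℝ → ℝ := fun t => (y - t) / √(y + a * t) - (1 - t) / √(1 + a * t) -
    √(1 + a) / a * (y ^ (a / (1 + a)) - 1) * √((t + a) / (1 + a * t)) with hg
  have hg0 : ContinuousAt g 0 := by
    have h1 : √(y + a * 0) ≠ 0 := (Real.sqrt_pos.2 (by simpa using hy)).ne'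
    have h2 : √(1 + a * 0) ≠ 0 := by simp
    have h3 : 1 + a * 0 ≠ 0 := by simp
    fun_prop (disch := assumption)
  have hgv : g 0 = strongShockDefect a y := by
    simp [hg, strongShockDefect]
  have h1 : Filter.Tendsto (fun x : ℝ => g x⁻¹) Filter.atTop (𝓝 (strongShockDefect a y)) :=
    hgv ▸ hg0.tendsto.comp tendsto_inv_atTop_zero
  refine h1.congr' ?_
  filter_upwards [Filter.eventually_gt_atTop 1, Filter.eventually_gt_atTop y⁻¹] with x hx hxy
  have hx0 : 0 < x := by linarith
  have hxy1 : 1 < x * y := by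
    rwa [← div_lt_iff₀ hy, one_div]
  have hs : 0 < √x := Real.sqrt_pos.2 hx0
  have hss : √x ^ 2 = x := Real.sq_sqrt hx0.le
  have e1 : √(x * y + a) = √x * √(y + a * x⁻¹) := by
    rw [← Real.sqrt_mul hx0.le]
    congr 1
    field_simp
  have e2 : √(x + a) = √x * √(1 + a * x⁻¹) := by
    rw [← Real.sqrt_mul hx0.le]
    congr 1
    field_simp
  have e3 : √(x * (1 + a * x) / (x + a)) = √x * √((x⁻¹ + a) / (1 + a * x⁻¹)) := by
    rw [← Real.sqrt_mul hx0.le]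
    congr 1
    field_simp
  have hp1 : 0 < √(y + a * x⁻¹) := Real.sqrt_pos.2 (by positivity)
  have hp2 : 0 < √(1 + a * x⁻¹) := Real.sqrt_pos.2 (by positivity)
  rw [jumpDefect, jump_of_ge a hxy1.le, jump_of_ge a hx.le, jump_of_le a hy'.le,
    acoustic_of_lt a hx, shockJump, shockJump, e1, e2, e3, sub_div, sub_div]
  simp only [hg]
  congr 1
  · congr 1
    · rw [div_div, div_eq_div_iff hp1.ne' (by positivity)]
      have : (y - x⁻¹) * x = x * y - 1 := by field_simp
      linear_combination (y - x⁻¹) * √(y + a * x⁻¹) * hss + √(y + a * x⁻¹) * this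
    · rw [div_div, div_eq_div_iff hp2.ne' (by positivity)]
      have : (1 - x⁻¹) * x = x - 1 := by field_simp
      linear_combination (1 - x⁻¹) * √(1 + a * x⁻¹) * hss + √(1 + a * x⁻¹) * this
  · field_simp

/-! ### Weak shocks -/

lemma tendsto_acoustic_sub_rpow {a : ℝ} (ha : 0 < a) :
    Filter.Tendsto (fun x => (acoustic a x - x ^ (a / (1 + a))) / (x - 1) ^ 3) (𝓝[>] 1)
      (𝓝 (a * (1 - a) / (6 * (1 + a) ^ 3))) := by
  -- `acoustic a x = x ^ ζ * exp (E x)`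
  set E : ℝ → ℝ := fun x => 1 / 2 * (Real.log x + Real.log (1 + a * x) - Real.log (x + a)) -
    a / (1 + a) * Real.log x with hE
  have hEd : ∀ x : ℝ, 0 < x → HasDerivAt E
      (a * (1 - a) * (x - 1) ^ 2 / (2 * (1 + a) * x * (x + a) * (1 + a * x))) x := fun x hx => by
    have h1 := (hasDerivAt_id x).log hx.ne'
    have h2 := (((hasDerivAt_id x).const_mul a).const_add 1).log (by simp only [id]; positivity)
    have h3 := ((hasDerivAt_id x).add_const a).log (by simp only [id]; positivity)
    refine ((((h1.add h2).sub h3).const_mul (1 / 2)).sub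
      (h1.const_mul (a / (1 + a)))).congr_deriv ?_
    simp only [id]
    field_simp
    ring
  have hE1 : E 1 = 0 := by
    simp [hE]
  have hEc : ContinuousAt E 1 := (hEd 1 one_pos).continuousAt
  have hexp : Filter.Tendsto (fun x => Real.exp (E x)) (𝓝[>] 1) (𝓝 1) := by
    have := (Real.continuous_exp.continuousAt.comp hEc).tendsto.mono_left
      (nhdsWithin_le_nhds (s := Set.Ioi 1))
    simpa [hE1, Function.comp_def] using this
  have hmain : Filter.Tendsto (fun x => (Real.exp (E x) - 1) / (x - 1) ^ 3) (𝓝[>] 1)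
      (𝓝 (a * (1 - a) / (6 * (1 + a) ^ 3))) := by
    refine HasDerivAt.lhopital_zero_nhdsGT
      (f' := fun x => Real.exp (E x) *
        (a * (1 - a) * (x - 1) ^ 2 / (2 * (1 + a) * x * (x + a) * (1 + a * x))))
      (g' := fun x => 3 * (x - 1) ^ 2) ?_ ?_ ?_ ?_ ?_ ?_
    · filter_upwards [self_mem_nhdsWithin] with x hx
      exact ((hEd x (one_pos.trans hx)).exp).sub_const 1
    · filter_upwards with x
      exact (((hasDerivAt_id x).sub_const 1).pow 3).congr_deriv (by simp)
    · filter_upwards [self_mem_nhdsWithin] with x hx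
      have : 0 < x - 1 := sub_pos.2 hx
      positivity
    · simpa using hexp.sub_const 1
    · have : ContinuousAt (fun x : ℝ => (x - 1) ^ 3) 1 := by fun_prop
      simpa using this.tendsto.mono_left (nhdsWithin_le_nhds (s := Set.Ioi 1))
    · have h1 : ContinuousAt (fun x : ℝ => a * (1 - a) /
          (6 * (1 + a) * x * (x + a) * (1 + a * x))) 1 := by
        have : 6 * (1 + a) * 1 * (1 + a) * (1 + a * 1) ≠ 0 := by positivity
        fun_prop (disch := assumption)
      have h2 := hexp.mul (h1.tendsto.mono_left (nhdsWithin_le_nhds (s := Set.Ioi 1)))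
      have h3 : 1 * (a * (1 - a) / (6 * (1 + a) * 1 * (1 + a) * (1 + a * 1))) =
          a * (1 - a) / (6 * (1 + a) ^ 3) := by
        rw [one_mul]; congr 1; ring
      rw [h3] at h2
      refine h2.congr' ?_
      filter_upwards [self_mem_nhdsWithin] with x hx
      have h4 : 0 < x := one_pos.trans hx
      have h5 : 0 < x - 1 := sub_pos.2 hx
      field_simp
      ring
  have hpow : Filter.Tendsto (fun x : ℝ => x ^ (a / (1 + a))) (𝓝[>] 1) (𝓝 1) := by
    have := (Real.continuousAt_rpow_const 1 (a / (1 + a)) (Or.inl one_ne_zero)).tendsto.mono_left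
      (nhdsWithin_le_nhds (s := Set.Ioi 1))
    simpa using this
  have hfin := hpow.mul hmain
  rw [one_mul] at hfin
  refine hfin.congr' ?_
  filter_upwards [self_mem_nhdsWithin] with x hx
  have hx1 : 1 < x := hx
  have hx0 : 0 < x := one_pos.trans hx1
  have h1 : acoustic a x = x ^ (a / (1 + a)) * Real.exp (E x) := by
    rw [acoustic_of_lt a hx1, Real.rpow_def_of_pos hx0, ← Real.exp_add,
      ← Real.exp_log (Real.sqrt_pos.2 (show 0 < x * (1 + a * x) / (x + a) by positivity)),
      Real.log_sqrt (by positivity), Real.log_div (by positivity) (by positivity),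
      Real.log_mul (by positivity) (by positivity)]
    congr 1
    simp only [hE]
    ring
  rw [h1]
  ring

/-- The cube of `x - 1` is split off by rationalizing twice. -/
lemma tendsto_acoustic_sub_one_sub {a : ℝ} (ha : 0 < a) :
    Filter.Tendsto (fun x => (acoustic a x - 1 - shockJump a x / (√(1 + a) / a)) / (x - 1) ^ 3)
      (𝓝[>] 1) (𝓝 (a / (8 * (1 + a) ^ 3))) := by
  set g : ℝ → ℝ := fun x => a * ((1 - a) + a ^ 2 * (x + 1) ^ 2 /
    (√(x * (1 + a * x)) + √(x + a)) ^ 2) / (√(1 + a) * √(x + a) *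
    (√(x * (1 + a * x)) + √(x + a)) * (√(1 + a) * (x + 1) + √(x * (1 + a * x)) + √(x + a))) with hg
  have hC0 : 0 < √(1 + a) := Real.sqrt_pos.2 (by positivity)
  have hC2 : √(1 + a) ^ 2 = 1 + a := Real.sq_sqrt (by positivity)
  have hg1 : g 1 = a / (8 * (1 + a) ^ 3) := by
    simp only [hg, mul_one, one_mul]
    have h1 : (√(1 + a) + √(1 + a)) ^ 2 = 4 * (1 + a) := by
      linear_combination 4 * hC2
    have h2 : √(1 + a) * √(1 + a) * (√(1 + a) + √(1 + a)) *
        (√(1 + a) * (1 + 1) + √(1 + a) + √(1 + a)) = 8 * (1 + a) ^ 2 := by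
      linear_combination 8 * (√(1 + a) ^ 2 + 1 + a) * hC2
    rw [h1, h2]
    field_simp
    ring
  have hgc : ContinuousAt g 1 := by
    have h1 : (√(1 * (1 + a * 1)) + √(1 + a)) ^ 2 ≠ 0 := by
      simp only [mul_one, one_mul]; positivity
    have h2 : √(1 + a) * √(1 + a) * (√(1 * (1 + a * 1)) + √(1 + a)) *
        (√(1 + a) * (1 + 1) + √(1 * (1 + a * 1)) + √(1 + a)) ≠ 0 := by
      simp only [mul_one, one_mul]; positivity
    fun_prop (disch := assumption)
  refine ((hg1 ▸ hgc.tendsto).mono_left (nhdsWithin_le_nhds (s := Set.Ioi 1))).congr' ?_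
  filter_upwards [self_mem_nhdsWithin] with x hx
  have hx1 : 1 < x := hx
  have hx0 : 0 < x := one_pos.trans hx1
  rw [acoustic_of_lt a hx1, shockJump, Real.sqrt_div (by positivity)]
  simp only [hg]
  obtain ⟨A, hA⟩ : ∃ A, A = √(x * (1 + a * x)) := ⟨_, rfl⟩
  obtain ⟨B, hB⟩ : ∃ B, B = √(x + a) := ⟨_, rfl⟩
  obtain ⟨C, hC⟩ : ∃ C, C = √(1 + a) := ⟨_, rfl⟩
  have hA2 : A ^ 2 = x * (1 + a * x) := hA ▸ Real.sq_sqrt (by positivity)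
  have hB2 : B ^ 2 = x + a := hB ▸ Real.sq_sqrt (by positivity)
  have hA0 : 0 < A := hA ▸ Real.sqrt_pos.2 (by positivity)
  have hB0 : 0 < B := hB ▸ Real.sqrt_pos.2 (by positivity)
  rw [← hC] at hC0 hC2
  rw [← hA, ← hB, ← hC]
  have hxm : 0 < x - 1 := by linarith
  have hAB : A - B = a * (x ^ 2 - 1) / (A + B) := by
    field_simp
    linear_combination hA2 - hB2
  have hbr : C * (x + 1) - (A + B) = (x - 1) ^ 2 * ((1 - a) + a ^ 2 * (x + 1) ^ 2 / (A + B) ^ 2) /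
      (C * (x + 1) + A + B) := by
    have h1 : (A - B) ^ 2 = (x - 1) ^ 2 * (a ^ 2 * (x + 1) ^ 2 / (A + B) ^ 2) := by
      rw [hAB]; field_simp; ring
    rw [eq_div_iff (by positivity)]
    linear_combination (x + 1) ^ 2 * hC2 - 2 * hA2 - 2 * hB2 + h1
  have h2 : A / B - 1 - (x - 1) / B / (C / a) =
      a * (x - 1) * (C * (x + 1) - (A + B)) / (C * B * (A + B)) := by
    have h3 : A / B - 1 - (x - 1) / B / (C / a) = ((A - B) - a * (x - 1) / C) / B := by
      field_simp
    rw [h3, hAB]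
    field_simp
    ring
  rw [h2, hbr]
  field_simp

/-- As `x ↓ 1`, the zero of `H(x, ·)` lies below `1 / x`, where `H(x, y) = 0` is a linear equation
for the acoustic variable `y ^ ζ`. -/
lemma tendsto_zero_of_jumpDefect {a : ℝ} (ha : 0 < a) (ha' : a < 1 / 4) {h : ℝ → ℝ}
    (hh : ∀ x y : ℝ, 1 < x → 0 < y → y < 1 → jumpDefect a x y = 0 → y = h x) :
    Filter.Tendsto h (𝓝[>] 1) (𝓝 ((3 / (4 * (1 - a))) ^ ((1 + a) / a))) := by
  have ha1 : 0 < 1 - a := by linarith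
  have he' : 0 < (1 + a) / a := by positivity
  have hN := tendsto_acoustic_sub_one_sub ha
  have hD := tendsto_acoustic_sub_rpow ha
  have hDpos : 0 < a * (1 - a) / (6 * (1 + a) ^ 3) := by positivity
  have hL0 : 0 < 3 / (4 * (1 - a)) := by positivity
  have hL1 : 3 / (4 * (1 - a)) < 1 := by rw [div_lt_one (by positivity)]; linarith
  have hR : Filter.Tendsto (fun x => (acoustic a x - 1 - shockJump a x / (√(1 + a) / a)) /
      (acoustic a x - x ^ (a / (1 + a)))) (𝓝[>] 1) (𝓝 (3 / (4 * (1 - a)))) := by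
    have h1 := hN.div hD hDpos.ne'
    have h2 : a / (8 * (1 + a) ^ 3) / (a * (1 - a) / (6 * (1 + a) ^ 3)) = 3 / (4 * (1 - a)) := by
      field_simp
      norm_num
    rw [h2] at h1
    refine h1.congr' ?_
    filter_upwards [self_mem_nhdsWithin] with x hx
    have hx1 : 0 < x - 1 := sub_pos.2 hx
    exact div_div_div_cancel_right₀ (pow_pos hx1 3).ne' _ _
  have hY := ((Real.continuousAt_rpow_const _ ((1 + a) / a) (Or.inl hL0.ne')).tendsto.comp hR)
  have hY1 : (3 / (4 * (1 - a))) ^ ((1 + a) / a) < 1 := Real.rpow_lt_one hL0.le hL1 he'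
  have hid : Filter.Tendsto (fun x : ℝ => x) (𝓝[>] 1) (𝓝 1) := nhdsWithin_le_nhds
  have hxY := hid.mul hY
  rw [one_mul] at hxY
  refine hY.congr' ?_
  filter_upwards [self_mem_nhdsWithin, hD.eventually (lt_mem_nhds hDpos),
    hR.eventually (lt_mem_nhds hL0), hR.eventually (gt_mem_nhds hL1),
    hxY.eventually (gt_mem_nhds hY1)] with x hx hDx hR0 hR1 hxYx
  have hx1 : 1 < x := hx
  have hx0 : 0 < x := one_pos.trans hx1
  have hDx' : acoustic a x - x ^ (a / (1 + a)) ≠ 0 := by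
    rintro h0
    rw [h0, zero_div] at hDx
    exact hDx.false
  simp only [Function.comp] at hxYx ⊢
  obtain ⟨s, hs⟩ : ∃ s, s = (acoustic a x - 1 - shockJump a x / (√(1 + a) / a)) /
      (acoustic a x - x ^ (a / (1 + a))) := ⟨_, rfl⟩
  rw [← hs] at hR0 hR1 hxYx ⊢
  refine hh x _ hx1 (Real.rpow_pos_of_pos hR0 _) (Real.rpow_lt_one hR0.le hR1 he') ?_
  rw [eq_div_iff hDx'] at hs
  rw [jumpDefect, jump_of_le a hxYx.le, jump_of_ge a hx1.le, jump_rpow_of_le ha hR0.le hR1.le,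
    Real.mul_rpow hx0.le (Real.rpow_nonneg hR0.le _), rpow_rpow_acoustic ha hR0.le]
  have hμ : √(1 + a) / a ≠ 0 := by positivity
  have h3 : √(1 + a) / a * (shockJump a x / (√(1 + a) / a)) = shockJump a x :=
    mul_div_cancel₀ _ hμ
  linear_combination -(√(1 + a) / a) * hs + h3

/-! ### The wave functions of the gas in terms of the normalized curve -/

lemma aPar_pos {γ : ℝ} (hγ : 1 < γ) : 0 < aPar γ := div_pos (by linarith) (by linarith)

lemma aPar_lt {γ : ℝ} (hγ : 1 < γ) (hγ' : γ < 5 / 3) : aPar γ < 1 / 4 := by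
  rw [aPar, div_lt_div_iff₀ (by linarith) (by norm_num)]
  linarith

lemma aPar_lt_one {γ : ℝ} (hγ : 1 < γ) : aPar γ < 1 := by
  rw [aPar, div_lt_one (by linarith)]
  linarith

lemma kappaPar_pos {γ : ℝ} (hγ : 1 < γ) : 0 < kappaPar γ :=
  Real.sqrt_pos.2 (sub_pos.2 (aPar_lt_one hγ))

lemma zetaPar_eq {γ : ℝ} (hγ : 1 < γ) : zetaPar γ = (1 - 1 / γ) / 2 := by
  have h1 : γ + 1 ≠ 0 := by linarith
  have h2 : γ ≠ 0 := by linarith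
  have h3 : 1 + (γ - 1) / (γ + 1) = 2 * γ / (γ + 1) := by
    field_simp
    ring
  rw [zetaPar, aPar, h3]
  field_simp

lemma one_div_zetaPar (γ : ℝ) : 1 / zetaPar γ = (1 + aPar γ) / aPar γ := by
  rw [zetaPar, one_div_div]

lemma nuPar_eq {γ : ℝ} (hγ : 1 < γ) : nuPar γ = kappaPar γ * (√(1 + aPar γ) / aPar γ) := by
  have h := aPar_lt_one hγ
  rw [nuPar, kappaPar, show 1 - aPar γ ^ 2 = (1 - aPar γ) * (1 + aPar γ) by ring,
    Real.sqrt_mul (by linarith), mul_div_assoc]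

lemma psiB_eq {γ : ℝ} (hγ : 1 < γ) (q : ℝ) : psiB γ q = kappaPar γ * jump (aPar γ) q := by
  unfold psiB jump shockJump
  split_ifs
  · rw [nuPar_eq hγ, zetaPar, mul_assoc]
  · rw [mul_div_assoc]

lemma phiB_pos {γ q : ℝ} (hγ : 1 < γ) (hq : 0 < q) : 0 < phiB γ q := by
  have := aPar_pos hγ
  unfold phiB
  split_ifs <;> positivity

lemma MFun_eq {γ q : ℝ} (hγ : 1 < γ) (hq : 0 < q) : MFun γ q = acoustic (aPar γ) q := by
  unfold MFun phiB acoustic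
  split_ifs
  · have h : q * q ^ (-1 / γ) = q ^ (1 - 1 / γ) := by
      rw [show 1 - 1 / γ = 1 + -1 / γ by ring, Real.rpow_add hq, Real.rpow_one]
    rw [h, Real.sqrt_eq_rpow, ← Real.rpow_mul hq.le]
    congr 1
    have := zetaPar_eq hγ
    rw [zetaPar] at this
    rw [this]
    ring
  · rw [mul_div_assoc]

lemma acoustic_sq {γ q : ℝ} (hγ : 1 < γ) (hq : 0 < q) :
    acoustic (aPar γ) q ^ 2 = q * phiB γ q := by
  rw [← MFun_eq hγ hq, MFun, Real.sq_sqrt (mul_pos hq (phiB_pos hγ hq)).le]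

lemma phiF_mul_phiB_inv {γ q : ℝ} (hγ : 1 < γ) (hq : 0 < q) : phiF γ q * phiB γ q⁻¹ = 1 := by
  have ha := aPar_pos hγ
  unfold phiF phiB
  by_cases h : 1 ≤ q
  · rw [if_pos h, if_pos (inv_le_one_of_one_le₀ h), Real.inv_rpow hq.le]
    exact mul_inv_cancel₀ (Real.rpow_pos_of_pos hq _).ne'
  · rw [if_neg h, if_neg (not_le.2 ((one_lt_inv₀ hq).2 (not_le.1 h)))]
    field_simp

/-- Reading a shock from right to left maps the Hugoniot curve to itself. -/
lemma shockJump_inv_mul_acoustic {a x : ℝ} (ha : 0 < a) (hx : 1 < x) :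
    shockJump a x⁻¹ * acoustic a x = -jump a x := by
  have hx0 : 0 < x := by linarith
  have e1 : √(x⁻¹ + a) = √(1 + a * x) / √x := by
    rw [← Real.sqrt_div (by positivity)]
    congr 1
    field_simp
  have h2 : 0 < √x := Real.sqrt_pos.2 hx0
  have h3 : √x ^ 2 = x := Real.sq_sqrt hx0.le
  have h4 : 0 < √(1 + a * x) := Real.sqrt_pos.2 (by positivity)
  have h5 : 0 < √(x + a) := Real.sqrt_pos.2 (by positivity)
  rw [acoustic_of_lt a hx, jump_of_ge a hx.le, shockJump, shockJump, e1,
    Real.sqrt_div (by positivity), Real.sqrt_mul hx0.le]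
  field_simp
  rw [h3]
  ring

/-- Reflection exchanges forward and backward waves. -/
lemma psiF_mul_acoustic_inv {γ q : ℝ} (hγ : 1 < γ) (hq : 0 < q) :
    psiF γ q * acoustic (aPar γ) q⁻¹ = -(kappaPar γ * jump (aPar γ) q⁻¹) := by
  have ha := aPar_pos hγ
  by_cases h : 1 ≤ q
  · have h1 := inv_le_one_of_one_le₀ h
    have h2 : 0 < q ^ (aPar γ / (1 + aPar γ)) := Real.rpow_pos_of_pos hq _
    rw [psiF, if_pos h, acoustic_of_le _ h1, jump_of_le _ h1, nuPar_eq hγ, zetaPar,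
      Real.inv_rpow hq.le]
    field_simp
    ring
  · have h1 := (one_lt_inv₀ hq).2 (not_le.1 h)
    have h2 := shockJump_inv_mul_acoustic ha h1
    rw [inv_inv, shockJump] at h2
    rw [psiF, if_neg h]
    linear_combination kappaPar γ * h2

lemma HFun_eq {γ x y : ℝ} (hγ : 1 < γ) (hx : 0 < x) :
    HFun γ x y = kappaPar γ * jumpDefect (aPar γ) x y := by
  rw [HFun, jumpDefect, psiB_eq hγ, psiB_eq hγ, psiB_eq hγ, MFun_eq hγ hx]
  ring

lemma alphaFun_of_lt {γ q : ℝ} (hγ : 1 < γ) (hq : q < 1) :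
    alphaFun γ q = kappaPar γ * (shockJump (aPar γ) q -
      √(1 + aPar γ) / aPar γ * (q ^ (aPar γ / (1 + aPar γ)) - 1)) := by
  rw [alphaFun, psiB_eq hγ, psiF, if_neg hq.not_ge, jump_of_le _ hq.le, shockJump]
  ring

lemma alphaFun_of_ge {γ q : ℝ} (hγ : 1 < γ) (hq : 1 ≤ q) :
    alphaFun γ q = kappaPar γ * (√(1 + aPar γ) / aPar γ * (q ^ (aPar γ / (1 + aPar γ)) - 1) -
      shockJump (aPar γ) q) := by
  rw [alphaFun, psiB_eq hγ, psiF, if_pos hq, jump_of_ge _ hq, nuPar_eq hγ, zetaPar]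
  ring

/-! ### The Riemann problem of an interaction -/

/-- The velocity defect, divided by `κ √(τ p)`, of the wave fan with backward strength `B` between
the extreme states of the interaction: the fan resolves the Riemann problem when it vanishes. -/
noncomputable def fanDefect (a x y B : ℝ) : ℝ :=
  jump a B + acoustic a x * acoustic a y * jump a (B / (x * y)) -
    (jump a x + jump a y * acoustic a x)

lemma strictMonoOn_fanDefect {a x y : ℝ} (ha : 0 < a) (hx : 0 < x) (hy : 0 < y) :
    StrictMonoOn (fanDefect a x y) (Set.Ici 0) := by
  intro B hB B' hB' h
  have hxy := mul_pos hx hy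
  have h1 := strictMonoOn_jump ha hB hB' h
  have h2 := strictMonoOn_jump ha (div_nonneg hB hxy.le) (div_nonneg hB' hxy.le)
    (div_lt_div_of_pos_right h hxy)
  have h3 := mul_lt_mul_of_pos_left h2 (mul_pos (acoustic_pos ha hx) (acoustic_pos ha hy))
  unfold fanDefect
  linarith

lemma continuousOn_fanDefect {a x y : ℝ} (ha : 0 < a) (hx : 0 < x) (hy : 0 < y) :
    ContinuousOn (fanDefect a x y) (Set.Ici 0) := by
  have h1 : ContinuousOn (fun B => jump a (B / (x * y))) (Set.Ici 0) :=
    (continuousOn_jump ha).comp (by fun_prop) fun B hB => div_nonneg hB (mul_pos hx hy).le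
  exact ((continuousOn_jump ha).add (continuousOn_const.mul h1)).sub continuousOn_const

lemma fanDefect_zero {a : ℝ} (ha : 0 < a) (x y : ℝ) :
    fanDefect a x y 0 = -(√(1 + a) / a * (1 + acoustic a x * acoustic a y)) -
      (jump a x + jump a y * acoustic a x) := by
  have h : jump a 0 = -(√(1 + a) / a) := by
    rw [jump_of_le a zero_le_one, Real.zero_rpow (by positivity)]
    ring
  rw [fanDefect, zero_div, h]
  ring

lemma fanDefect_mul {a x y : ℝ} (hx : 0 < x) (hy : 0 < y) :
    fanDefect a x y (x * y) = jumpDefect a x y := by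
  rw [fanDefect, div_self (mul_pos hx hy).ne', jump_one, jumpDefect]
  ring

lemma fanDefect_one {a x y : ℝ} (ha : 0 < a) (hx : 1 < x) :
    fanDefect a x y 1 = acoustic a x * transmittedDefect a x y := by
  have h := shockJump_inv_mul_acoustic ha hx
  rw [fanDefect, transmittedDefect, jump_one, one_div]
  linear_combination -h

lemma jump_tendsto_atTop {a : ℝ} (ha : 0 < a) :
    Filter.Tendsto (jump a) Filter.atTop Filter.atTop := by
  have h1 : Filter.Tendsto (fun q : ℝ => √(q + a)) Filter.atTop Filter.atTop :=
    Real.tendsto_sqrt_atTop.comp (Filter.tendsto_atTop_add_const_right _ a Filter.tendsto_id)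
  refine Filter.tendsto_atTop_mono' _ ?_ (Filter.tendsto_atTop_add_const_right _ (-(1 + a)) h1)
  filter_upwards [Filter.eventually_ge_atTop 1] with q hq
  have h2 : √(q + a) ^ 2 = q + a := Real.sq_sqrt (by positivity)
  have h3 : 1 ≤ √(q + a) := Real.one_le_sqrt.2 (by linarith)
  rw [jump_of_ge a hq, shockJump, le_div_iff₀ (by positivity)]
  nlinarith

lemma exists_fanDefect_eq_zero {a x y : ℝ} (ha : 0 < a) (hx : 0 < x) (hy : 0 < y)
    (h0 : fanDefect a x y 0 < 0) : ∃ B, 0 < B ∧ fanDefect a x y B = 0 := by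
  obtain ⟨B, hB1, hB2⟩ := (((jump_tendsto_atTop ha).eventually_ge_atTop
    (jump a x + jump a y * acoustic a x)).and (Filter.eventually_ge_atTop (max (x * y) 0))).exists
  have hxy := mul_pos hx hy
  have h1 : x * y ≤ B := (le_max_left _ _).trans hB2
  have hB0 : 0 < B := hxy.trans_le h1
  have h2 : 0 ≤ jump a (B / (x * y)) := by
    have h3 : 1 ≤ B / (x * y) := (one_le_div hxy).2 h1
    simpa using (strictMonoOn_jump ha).monotoneOn (Set.mem_Ici.2 zero_le_one)
      (Set.mem_Ici.2 (zero_le_one.trans h3)) h3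
  have h4 : 0 ≤ fanDefect a x y B := by
    have := mul_nonneg (mul_pos (acoustic_pos ha hx) (acoustic_pos ha hy)).le h2
    unfold fanDefect
    linarith
  obtain ⟨b, hb, hb0⟩ := intermediate_value_Ioc hB0.le
    ((continuousOn_fanDefect ha hx hy).mono Set.Icc_subset_Ici_self) ⟨h0, h4⟩
  exact ⟨b, hb.1, hb0⟩

lemma overtakingRight_u {γ x y : ℝ} (hγ : 1 < γ) (hx : 0 < x) (l : GasState) :
    (overtakingRight γ x y l).u = l.u - kappaPar γ * √(l.τ * l.p) *
      (jump (aPar γ) x + jump (aPar γ) y * acoustic (aPar γ) x) := by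
  have h : √(phiB γ x * l.τ * (x * l.p)) = acoustic (aPar γ) x * √(l.τ * l.p) := by
    rw [← MFun_eq hγ hx, MFun, ← Real.sqrt_mul (mul_pos hx (phiB_pos hγ hx)).le]
    congr 1
    ring
  simp only [overtakingRight, backwardWave, h, psiB_eq hγ]
  ring

lemma vacuumFree_iff {γ x y : ℝ} (hγ : 1 < γ) (hx : 0 < x) (hy : 0 < y) {l : GasState}
    (hτ : 0 < l.τ) (hp : 0 < l.p) :
    VacuumFree γ l (overtakingRight γ x y l) ↔ fanDefect (aPar γ) x y 0 < 0 := by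
  have ha := aPar_pos hγ
  have hP : 0 < √(l.τ * l.p) := Real.sqrt_pos.2 (mul_pos hτ hp)
  have hκ := kappaPar_pos hγ
  have h1 : soundSpeed γ l = √γ * √(l.τ * l.p) := by
    rw [soundSpeed, mul_assoc, Real.sqrt_mul (by linarith)]
  have h2 : soundSpeed γ (overtakingRight γ x y l) =
      √γ * (acoustic (aPar γ) x * acoustic (aPar γ) y * √(l.τ * l.p)) := by
    rw [soundSpeed, ← MFun_eq hγ hx, ← MFun_eq hγ hy, MFun, MFun,
      ← Real.sqrt_mul (mul_pos hx (phiB_pos hγ hx)).le,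
      ← Real.sqrt_mul (mul_pos (mul_pos hx (phiB_pos hγ hx)) (mul_pos hy (phiB_pos hγ hy))).le,
      ← Real.sqrt_mul (by linarith)]
    congr 1
    simp only [overtakingRight, backwardWave]
    ring
  have h3 : 2 / (γ - 1) * √γ = kappaPar γ * (√(1 + aPar γ) / aPar γ) := by
    have hg : 0 < γ - 1 := by linarith
    have h4 : 1 - aPar γ ^ 2 = (2 / (γ + 1)) ^ 2 * γ := by
      rw [aPar]; field_simp; ring
    rw [← nuPar_eq hγ, nuPar, h4, Real.sqrt_mul (by positivity), Real.sqrt_sq (by positivity), aPar]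
    field_simp
  have h5 : 2 / (γ - 1) * (soundSpeed γ (overtakingRight γ x y l) + soundSpeed γ l) -
      ((overtakingRight γ x y l).u - l.u) =
      kappaPar γ * √(l.τ * l.p) * -fanDefect (aPar γ) x y 0 := by
    rw [h1, h2, overtakingRight_u hγ hx l, fanDefect_zero ha]
    linear_combination (acoustic (aPar γ) x * acoustic (aPar γ) y + 1) * √(l.τ * l.p) * h3
  rw [VacuumFree, ← sub_pos, h5, mul_pos_iff_of_pos_left (mul_pos hκ hP), neg_pos]

/-- The pressure and specific-volume equations determine the strengths of the forward wave and of
the contact; the velocity equation then says that the defect vanishes. -/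
lemma resolves_regular_iff {γ x y : ℝ} (hγ : 1 < γ) (hx : 0 < x) (hy : 0 < y) {l : GasState}
    (hτ : 0 < l.τ) (hp : 0 < l.p) (B C F : ℝ) :
    (WaveFan.regular B C F).Resolves γ l (overtakingRight γ x y l) ↔
      0 < B ∧ fanDefect (aPar γ) x y B = 0 ∧
        C = phiB γ x * phiB γ y * phiB γ (B / (x * y)) / phiB γ B ∧ F = x * y / B := by
  have ha := aPar_pos hγ
  have hP : 0 < √(l.τ * l.p) := Real.sqrt_pos.2 (mul_pos hτ hp)
  have hκ := kappaPar_pos hγ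
  have hxy := mul_pos hx hy
  have hφx := phiB_pos hγ hx
  have hφy := phiB_pos hγ hy
  have main : 0 < B → F = x * y / B →
      C = phiB γ x * phiB γ y * phiB γ (B / (x * y)) / phiB γ B →
      0 < C ∧ 0 < F ∧ phiF γ F * (C * (phiB γ B * l.τ)) = phiB γ y * (phiB γ x * l.τ) ∧
      (forwardWave γ F (contactWave C (backwardWave γ B l))).u -
        (overtakingRight γ x y l).u = -(kappaPar γ * √(l.τ * l.p)) * fanDefect (aPar γ) x y B := by
    intro hB hF hC
    have hFi : F⁻¹ = B / (x * y) := by rw [hF, inv_div]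
    have hF0 : 0 < F := hF ▸ div_pos hxy hB
    have hφB := phiB_pos hγ hB
    have hBxy : 0 < B / (x * y) := div_pos hB hxy
    have hφF := phiB_pos hγ hBxy
    have hC0 : 0 < C := by rw [hC]; positivity
    have hcancel := phiF_mul_phiB_inv hγ hF0
    have hrefl := psiF_mul_acoustic_inv hγ hF0
    rw [hFi] at hcancel hrefl
    have hMx := acoustic_pos ha hx
    have hMy := acoustic_pos ha hy
    have hMF := acoustic_pos ha hBxy
    refine ⟨hC0, hF0, ?_, ?_⟩
    · rw [hC]
      field_simp
      linear_combination hcancel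
    · have hroot : √(C * (phiB γ B * l.τ) * (B * l.p)) =
          acoustic (aPar γ) x * acoustic (aPar γ) y * acoustic (aPar γ) (B / (x * y)) *
            √(l.τ * l.p) := by
        rw [← Real.sqrt_sq (show 0 ≤ acoustic (aPar γ) x * acoustic (aPar γ) y *
          acoustic (aPar γ) (B / (x * y)) * √(l.τ * l.p) by positivity), mul_pow, mul_pow, mul_pow,
          acoustic_sq hγ hx, acoustic_sq hγ hy, acoustic_sq hγ hBxy,
          Real.sq_sqrt (mul_pos hτ hp).le, hC]
        congr 1
        field_simp
      rw [overtakingRight_u hγ hx l]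
      simp only [forwardWave, contactWave, backwardWave, hroot, psiB_eq hγ, fanDefect]
      linear_combination acoustic (aPar γ) x * acoustic (aPar γ) y * √(l.τ * l.p) * hrefl
  constructor
  · rintro ⟨hB, hC, hF, heq⟩
    have hφB := phiB_pos hγ hB
    have e1 := congrArg GasState.τ heq
    have e2 := congrArg GasState.u heq
    have e3 := congrArg GasState.p heq
    simp only [forwardWave, contactWave, backwardWave, overtakingRight] at e1 e3
    have hF' : F = x * y / B := by
      rw [eq_div_iff hB.ne']
      exact mul_right_cancel₀ hp.ne' (by linear_combination e3)
    have hFi : F⁻¹ = B / (x * y) := by rw [hF', inv_div]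
    have hcancel := phiF_mul_phiB_inv hγ hF
    rw [hFi] at hcancel
    have hC' : C = phiB γ x * phiB γ y * phiB γ (B / (x * y)) / phiB γ B := by
      rw [eq_div_iff hφB.ne']
      exact mul_right_cancel₀ hτ.ne'
        (by linear_combination phiB γ (B / (x * y)) * e1 - C * phiB γ B * l.τ * hcancel)
    obtain ⟨-, -, -, h4⟩ := main hB hF' hC'
    rw [e2, sub_self] at h4
    refine ⟨hB, ?_, hC', hF'⟩
    rcases mul_eq_zero.1 h4.symm with h | h
    · exact absurd h (neg_ne_zero.2 (mul_pos hκ hP).ne')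
    · exact h
  · rintro ⟨hB, hdef, hC, hF⟩
    obtain ⟨h1, h2, h3, h4⟩ := main hB hF hC
    rw [hdef, mul_zero, sub_eq_zero] at h4
    refine ⟨hB, h1, h2, GasState.ext h3 h4 ?_⟩
    simp only [forwardWave, contactWave, backwardWave, overtakingRight]
    rw [hF]
    field_simp

open Classical in
/-- The outgoing wave fan of the interaction: the regular fan whose backward strength is a root of
the velocity defect, and the fan with a vacuum if there is no such root. -/
noncomputable def outgoingFan (γ x y : ℝ) : WaveFan :=
  if h : ∃ B, 0 < B ∧ fanDefect (aPar γ) x y B = 0 then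
    .regular h.choose
      (phiB γ x * phiB γ y * phiB γ (h.choose / (x * y)) / phiB γ h.choose) (x * y / h.choose)
  else .vacuum

lemma outgoingFan_cases {γ x y : ℝ} (hγ : 1 < γ) (hx : 0 < x) (hy : 0 < y) :
    (∃ B, 0 < B ∧ fanDefect (aPar γ) x y B = 0 ∧ fanDefect (aPar γ) x y 0 < 0 ∧
      outgoingFan γ x y = .regular B (phiB γ x * phiB γ y * phiB γ (B / (x * y)) / phiB γ B)
        (x * y / B)) ∨
    (0 ≤ fanDefect (aPar γ) x y 0 ∧ outgoingFan γ x y = .vacuum) := by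
  by_cases h : ∃ B, 0 < B ∧ fanDefect (aPar γ) x y B = 0
  · have h1 := h.choose_spec
    refine Or.inl ⟨h.choose, h1.1, h1.2, ?_, by rw [outgoingFan, dif_pos h]⟩
    exact (strictMonoOn_fanDefect (aPar_pos hγ) hx hy Set.self_mem_Ici h1.1.le h1.1).trans_eq h1.2
  · refine Or.inr ⟨?_, by rw [outgoingFan, dif_neg h]⟩
    by_contra! h0
    exact h (exists_fanDefect_eq_zero (aPar_pos hγ) hx hy h0)

lemma resolves_iff_eq_outgoingFan {γ x y : ℝ} (hγ : 1 < γ) (hx : 0 < x) (hy : 0 < y)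
    {l : GasState} (hτ : 0 < l.τ) (hp : 0 < l.p) (w : WaveFan) :
    w.Resolves γ l (overtakingRight γ x y l) ↔ w = outgoingFan γ x y := by
  have hmono := strictMonoOn_fanDefect (aPar_pos hγ) hx hy
  have hvac := vacuumFree_iff hγ hx hy hτ hp
  rcases outgoingFan_cases hγ hx hy with ⟨B₀, hB₀, hd, h0, hout⟩ | ⟨h0, hout⟩
  · cases w with
    | regular B C F =>
      rw [resolves_regular_iff hγ hx hy hτ hp, hout, WaveFan.regular.injEq]
      constructor
      · rintro ⟨hB, hB0, rfl, rfl⟩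
        obtain rfl : B = B₀ := hmono.injOn hB.le hB₀.le (hB0.trans hd.symm)
        exact ⟨rfl, rfl, rfl⟩
      · rintro ⟨rfl, rfl, rfl⟩
        exact ⟨hB₀, hd, rfl, rfl⟩
    | vacuum => simp [WaveFan.Resolves, hvac, h0, hout]
  · cases w with
    | regular B C F =>
      rw [resolves_regular_iff hγ hx hy hτ hp, hout]
      refine ⟨fun h => ?_, fun h => by simp at h⟩
      have := hmono Set.self_mem_Ici h.1.le h.1
      linarith [h.2.1]
    | vacuum => simp [WaveFan.Resolves, hvac, h0, hout]

/-- The reflected wave is a rarefaction, absent, or a shock according to the sign of `H`, which is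
the velocity defect of the fan without a forward wave. -/
lemma forwardStrength_iff {γ x y : ℝ} (hγ : 1 < γ) (hx : 0 < x) (hy : 0 < y) :
    (1 < (outgoingFan γ x y).forwardStrength ↔ 0 < jumpDefect (aPar γ) x y) ∧
    ((outgoingFan γ x y).forwardStrength = 1 ↔ jumpDefect (aPar γ) x y = 0) ∧
    ((outgoingFan γ x y).forwardStrength < 1 ↔ jumpDefect (aPar γ) x y < 0) := by
  have hmono := strictMonoOn_fanDefect (aPar_pos hγ) hx hy
  have hxy := mul_pos hx hy
  rw [← fanDefect_mul hx hy]
  rcases outgoingFan_cases hγ hx hy with ⟨B, hB, hd, -, hout⟩ | ⟨h0, hout⟩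
  · rw [hout, ← hd]
    simp only [WaveFan.forwardStrength]
    refine ⟨?_, ?_, ?_⟩
    · rw [ENNReal.one_lt_ofReal, one_lt_div hB]
      exact (hmono.lt_iff_lt hB.le hxy.le).symm
    · rw [ENNReal.ofReal_eq_one, div_eq_one_iff_eq hB.ne']
      exact (hmono.injOn.eq_iff hxy.le hB.le).symm
    · rw [ENNReal.ofReal_lt_one, div_lt_one hB]
      exact (hmono.lt_iff_lt hxy.le hB.le).symm
  · have h1 := h0.trans_lt (hmono Set.self_mem_Ici hxy.le hxy)
    rw [hout]
    simp [WaveFan.forwardStrength, h1, h1.ne', h1.le]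

lemma backwardStrength_eq_one_iff {γ x y : ℝ} (hγ : 1 < γ) (hx : 1 < x) (hy : 0 < y) :
    (outgoingFan γ x y).backwardStrength = 1 ↔ transmittedDefect (aPar γ) x y = 0 := by
  have ha := aPar_pos hγ
  have hx0 : 0 < x := by linarith
  have hmono := strictMonoOn_fanDefect ha hx0 hy
  have h1 : transmittedDefect (aPar γ) x y = 0 ↔ fanDefect (aPar γ) x y 1 = 0 := by
    rw [fanDefect_one ha hx, mul_eq_zero, or_iff_right (acoustic_pos ha hx0).ne']
  rw [h1]
  rcases outgoingFan_cases hγ hx0 hy with ⟨B, hB, hd, -, hout⟩ | ⟨h0, hout⟩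
  · rw [hout]
    simp only [WaveFan.backwardStrength]
    constructor
    · rintro rfl
      exact hd
    · exact fun h => hmono.injOn hB.le (Set.mem_Ici.2 zero_le_one) (hd.trans h.symm)
  · have h2 := h0.trans_lt (hmono Set.self_mem_Ici (Set.mem_Ici.2 zero_le_one) one_pos)
    rw [hout]
    simp [WaveFan.backwardStrength, h2.ne']

/-! ### The curves `y = h(x)` and `y = k(x)` -/

/-- The root of `α` different from `1` is where the Hugoniot curve crosses the rarefaction curve:
above `1` the function `α` is negative. -/
lemma alphaFun_eq_zero_iff {γ y₀ : ℝ} (hγ : 1 < γ) (hγ' : γ < 5 / 3)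
    (hpos : ∀ q, 0 < q → q < y₀ → 0 < shockJump (aPar γ) q -
      √(1 + aPar γ) / aPar γ * (q ^ (aPar γ / (1 + aPar γ)) - 1))
    (hzero : shockJump (aPar γ) y₀ -
      √(1 + aPar γ) / aPar γ * (y₀ ^ (aPar γ / (1 + aPar γ)) - 1) = 0)
    (hneg : ∀ q, y₀ < q → q < 1 → shockJump (aPar γ) q -
      √(1 + aPar γ) / aPar γ * (q ^ (aPar γ / (1 + aPar γ)) - 1) < 0)
    (hy₀ : y₀ < 1) {q : ℝ} (hq : 0 < q) : alphaFun γ q = 0 ↔ q = 1 ∨ q = y₀ := by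
  have hκ := (kappaPar_pos hγ).ne'
  rcases lt_trichotomy q 1 with h | rfl | h
  · rw [alphaFun_of_lt hγ h, mul_eq_zero, or_iff_right hκ, or_iff_right h.ne]
    rcases lt_trichotomy q y₀ with h1 | rfl | h1
    · exact iff_of_false (hpos q hq h1).ne' h1.ne
    · exact iff_of_true hzero rfl
    · exact iff_of_false (hneg q h1 h).ne h1.ne'
  · refine iff_of_true ?_ (Or.inl rfl)
    rw [alphaFun_of_ge hγ le_rfl]
    simp
  · have h1 := lt_shockJump (aPar_pos hγ) (aPar_lt hγ hγ') h
    rw [alphaFun_of_ge hγ h.le, mul_eq_zero, or_iff_right hκ]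
    exact iff_of_false (by linarith) (by rintro (h2 | h2) <;> linarith)

/-- On the hyperbola `x y = 1` the velocity defect of the fan with `B = 1` is `α(y) / κ`. -/
lemma transmittedDefect_inv {a x : ℝ} (hx : 1 < x) : transmittedDefect a x x⁻¹ =
    shockJump a x⁻¹ - √(1 + a) / a * (x⁻¹ ^ (a / (1 + a)) - 1) := by
  have hx0 : 0 < x := by linarith
  rw [transmittedDefect, mul_inv_cancel₀ hx0.ne', inv_one, jump_one,
    jump_of_le a (inv_le_one_of_one_le₀ hx.le)]
  ring

/-- Where the transmitted wave disappears, the forward strength is `x y`. -/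
lemma jumpDefect_sign_of_transmittedDefect_eq_zero {a x y : ℝ} (ha : 0 < a) (hx : 1 < x)
    (hy : 0 < y) (h : transmittedDefect a x y = 0) :
    (y < x⁻¹ → jumpDefect a x y < 0) ∧ (x⁻¹ < y → 0 < jumpDefect a x y) := by
  have hx0 : 0 < x := by linarith
  have hxy := mul_pos hx0 hy
  have hmono := strictMonoOn_fanDefect ha hx0 hy
  have h1 : fanDefect a x y 1 = 0 := by rw [fanDefect_one ha hx, h, mul_zero]
  rw [← fanDefect_mul hx0 hy, ← h1]
  refine ⟨fun h2 => hmono hxy.le (Set.mem_Ici.2 zero_le_one) ?_,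
    fun h2 => hmono (Set.mem_Ici.2 zero_le_one) hxy.le ?_⟩
  · rwa [← lt_inv_mul_iff₀ hx0, mul_one]
  · rwa [← inv_mul_lt_iff₀ hx0, mul_one]

/-- The zero of `H(x, ·)` tends to the zero of the strong-shock limit of `H(x, y) / √x`. -/
lemma tendsto_atTop_zero_of_jumpDefect {a yStar : ℝ} (ha : 0 < a) (hy0 : 0 < yStar)
    (hy1 : yStar < 1) (hpos : ∀ y, 0 < y → y < yStar → 0 < strongShockDefect a y)
    (hneg : ∀ y, yStar < y → y < 1 → strongShockDefect a y < 0) {h : ℝ → ℝ}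
    (hh : ∀ x y : ℝ, 1 < x → 0 < y → y < 1 →
      (0 < jumpDefect a x y → y < h x) ∧ (jumpDefect a x y < 0 → h x < y)) :
    Filter.Tendsto h Filter.atTop (𝓝 yStar) := by
  refine tendsto_order.2 ⟨fun b hb => ?_, fun b hb => ?_⟩
  · obtain ⟨y, hby, hyy⟩ := exists_between (max_lt hb hy0)
    have hy : 0 < y := (le_max_right _ _).trans_lt hby
    have hy' : y < 1 := hyy.trans hy1
    filter_upwards [(tendsto_jumpDefect_div_sqrt ha hy hy').eventually
      (lt_mem_nhds (hpos y hy hyy)), Filter.eventually_gt_atTop 1] with x hx hx1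
    have hs : 0 < √x := Real.sqrt_pos.2 (by linarith)
    exact ((le_max_left _ _).trans_lt hby).trans
      ((hh x y hx1 hy hy').1 ((div_pos_iff_of_pos_right hs).1 hx))
  · obtain ⟨y, hyy, hby⟩ := exists_between (lt_min hb hy1)
    have hy : 0 < y := hy0.trans hyy
    have hy' : y < 1 := hby.trans_le (min_le_right _ _)
    filter_upwards [(tendsto_jumpDefect_div_sqrt ha hy hy').eventually
      (gt_mem_nhds (hneg y hyy hy')), Filter.eventually_gt_atTop 1] with x hx hx1
    have hs : 0 < √x := Real.sqrt_pos.2 (by linarith)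
    exact ((hh x y hx1 hy hy').2 (neg_of_div_neg_left hx hs.le)).trans
      (hby.trans_le (min_le_left _ _))

end GasDyn

theorem mainTheorem3 (γ : ℝ) (hγ₁ : 1 < γ) (hγ₂ : γ < 5 / 3) :
    -- the outgoing wave fan is well defined and depends only on the incoming strengths
    ∃ out : ℝ → ℝ → GasDyn.WaveFan,
      (∀ l : GasDyn.GasState, 0 < l.τ → 0 < l.p → ∀ x y : ℝ, GasDyn.IsOvertaking x y →
        ∀ w : GasDyn.WaveFan,
          w.Resolves γ l (GasDyn.overtakingRight γ x y l) ↔ w = out x y) ∧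
      -- shock-shock: the reflected wave is a rarefaction
      (∀ x y : ℝ, 1 < x → 1 < y → 1 < (out x y).forwardStrength) ∧
      -- shock-rarefaction
      (∃ (y₀ : ℝ) (h k : ℝ → ℝ),
        -- `y₀` is the unique root of `α` different from `1`
        0 < y₀ ∧ y₀ < 1 ∧ (∀ q : ℝ, 0 < q → (GasDyn.alphaFun γ q = 0 ↔ q = 1 ∨ q = y₀)) ∧
        (∀ x : ℝ, 1 < x → 0 < h x ∧ h x < 1 ∧ 0 < k x ∧ k x < 1) ∧
        (∀ x y : ℝ, 1 < x → 0 < y → y < 1 →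
          -- `{B = 1}` is the graph of `k`; `{H = 0} = {F = 1}` is the graph of `h`
          ((out x y).backwardStrength = 1 ↔ y = k x) ∧
          (GasDyn.HFun γ x y = 0 ↔ (out x y).forwardStrength = 1) ∧
          ((out x y).forwardStrength = 1 ↔ y = h x) ∧
          (1 < (out x y).forwardStrength ↔ y < h x) ∧
          ((out x y).forwardStrength < 1 ↔ h x < y)) ∧
        -- all three graphs pass through `(x₀, y₀)` with `x₀ = 1 / y₀`
        (h (1 / y₀) = y₀ ∧ k (1 / y₀) = y₀) ∧
        (∀ x : ℝ, 1 < x → x < 1 / y₀ → h x < k x ∧ k x < 1 / x) ∧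
        (∀ x : ℝ, 1 / y₀ < x → k x < h x ∧ 1 / x < k x) ∧
        -- horizontal asymptote, and the limit at `x = 1`
        (∃ yStar : ℝ, GasDyn.yHat γ < yStar ∧ yStar < 1 ∧
          Filter.Tendsto h Filter.atTop (𝓝 yStar)) ∧
        Filter.Tendsto h (𝓝[>] 1) (𝓝 (GasDyn.yOne γ)) ∧ GasDyn.yOne γ < 1) ∧
      -- rarefaction-shock: the reflected wave is a shock
      (∀ x y : ℝ, 0 < x → x < 1 → 1 < y → (out x y).forwardStrength < 1) := by
  have ha := GasDyn.aPar_pos hγ₁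
  have ha' := GasDyn.aPar_lt hγ₁ hγ₂
  refine ⟨GasDyn.outgoingFan γ, ?_, ?_, ?_, ?_⟩
  · intro l hτ hp x y hxy w
    have hpos : 0 < x ∧ 0 < y := by
      rcases hxy with h | h | h
      · exact ⟨one_pos.trans h.1, one_pos.trans h.2⟩
      · exact ⟨one_pos.trans h.1, h.2.1⟩
      · exact ⟨h.1, one_pos.trans h.2.2⟩
    exact GasDyn.resolves_iff_eq_outgoingFan hγ₁ hpos.1 hpos.2 hτ hp w
  · intro x y hx hy
    exact (GasDyn.forwardStrength_iff hγ₁ (one_pos.trans hx) (one_pos.trans hy)).1.2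
      (GasDyn.jumpDefect_pos_of_shock_shock ha ha' hx hy)
  · obtain ⟨y₀, hy₀, hy₀', hα0, hαpos, hαneg⟩ := GasDyn.exists_shock_rarefaction_crossing ha ha'
    have hex : ∀ x : ℝ, ∃ r, 1 < x → 0 < r ∧ r < 1 ∧ GasDyn.jumpDefect (GasDyn.aPar γ) x r = 0 ∧
        (∀ y, 0 < y → y < r → 0 < GasDyn.jumpDefect (GasDyn.aPar γ) x y) ∧
        ∀ y, r < y → y < 1 → GasDyn.jumpDefect (GasDyn.aPar γ) x y < 0 := fun x => by
      by_cases hx : 1 < x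
      · obtain ⟨r, hr⟩ := GasDyn.exists_jumpDefect_sign ha ha' hx
        exact ⟨r, fun _ => hr⟩
      · exact ⟨0, fun h => absurd h hx⟩
    have hexk : ∀ x : ℝ, ∃ r, 1 < x → 0 < r ∧ r < 1 ∧
        GasDyn.transmittedDefect (GasDyn.aPar γ) x r = 0 := fun x => by
      by_cases hx : 1 < x
      · obtain ⟨r, hr⟩ := GasDyn.exists_transmittedDefect_eq_zero ha hx
        exact ⟨r, fun _ => hr⟩
      · exact ⟨0, fun h => absurd h hx⟩
    choose h hh using hex
    choose k hk using hexk
    -- the sign of `H` tells on which side of the curve `y = h(x)` a point lies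
    have hsign : ∀ x y : ℝ, 1 < x → 0 < y → y < 1 →
        (0 < GasDyn.jumpDefect (GasDyn.aPar γ) x y ↔ y < h x) ∧
        (GasDyn.jumpDefect (GasDyn.aPar γ) x y = 0 ↔ y = h x) ∧
        (GasDyn.jumpDefect (GasDyn.aPar γ) x y < 0 ↔ h x < y) := fun x y hx hy hy' => by
      obtain ⟨-, -, h0, hp, hn⟩ := hh x hx
      rcases lt_trichotomy y (h x) with h1 | rfl | h1
      · have := hp y hy h1
        exact ⟨iff_of_true this h1, iff_of_false this.ne' h1.ne, iff_of_false this.not_gt h1.not_gt⟩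
      · simp [h0]
      · have := hn y h1 hy'
        exact ⟨iff_of_false this.not_gt h1.not_gt, iff_of_false this.ne h1.ne', iff_of_true this h1⟩
    have hkanti : ∀ x : ℝ, 1 < x → StrictAntiOn (GasDyn.transmittedDefect (GasDyn.aPar γ) x)
        (Set.Ioc 0 1) := fun x hx =>
      GasDyn.transmittedDefect_strictAntiOn ha ha' (one_pos.trans hx)
    have hkmem : ∀ x : ℝ, 1 < x → k x ∈ Set.Ioc (0 : ℝ) 1 := fun x hx =>
      ⟨(hk x hx).1, (hk x hx).2.1.le⟩
    have hkzero : ∀ x y : ℝ, 1 < x → 0 < y → y < 1 →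
        (GasDyn.transmittedDefect (GasDyn.aPar γ) x y = 0 ↔ y = k x) := fun x y hx hy hy' => by
      rw [← (hk x hx).2.2]
      exact (hkanti x hx).injOn.eq_iff ⟨hy, hy'.le⟩ (hkmem x hx)
    have hx₀ : 1 < 1 / y₀ := (one_lt_div hy₀).2 hy₀'
    have hx₀inv : (1 / y₀)⁻¹ = y₀ := by simp
    have hinv : ∀ x : ℝ, 1 < x → x⁻¹ ∈ Set.Ioc (0 : ℝ) 1 := fun x hx =>
      ⟨inv_pos.2 (one_pos.trans hx), inv_le_one_of_one_le₀ hx.le⟩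
    refine ⟨y₀, h, k, hy₀, hy₀',
      fun q hq => GasDyn.alphaFun_eq_zero_iff hγ₁ hγ₂ hαpos hα0 hαneg hy₀' hq,
      fun x hx => ⟨(hh x hx).1, (hh x hx).2.1, (hk x hx).1, (hk x hx).2.1⟩, ?_, ?_, ?_, ?_, ?_, ?_, ?_⟩
    · intro x y hx hy hy'
      obtain ⟨s1, s2, s3⟩ := hsign x y hx hy hy'
      have hF := GasDyn.forwardStrength_iff hγ₁ (one_pos.trans hx) hy
      refine ⟨?_, ?_, hF.2.1.trans s2, hF.1.trans s1, hF.2.2.trans s3⟩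
      · rw [GasDyn.backwardStrength_eq_one_iff hγ₁ hx hy, hkzero x y hx hy hy']
      · rw [hF.2.1, GasDyn.HFun_eq hγ₁ (one_pos.trans hx), mul_eq_zero,
          or_iff_right (GasDyn.kappaPar_pos hγ₁).ne']
    · have h1 : GasDyn.transmittedDefect (GasDyn.aPar γ) (1 / y₀) y₀ = 0 := by
        have := GasDyn.transmittedDefect_inv (a := GasDyn.aPar γ) hx₀
        rwa [hx₀inv, hα0] at this
      have h2 : GasDyn.jumpDefect (GasDyn.aPar γ) (1 / y₀) y₀ = 0 := by
        have h3 := GasDyn.fanDefect_one (y := y₀) ha hx₀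
        have h4 := GasDyn.fanDefect_mul (a := GasDyn.aPar γ) (one_pos.trans hx₀) hy₀
        rw [← h4, div_mul_cancel₀ 1 hy₀.ne', h3, h1, mul_zero]
      exact ⟨((hsign _ y₀ hx₀ hy₀ hy₀').2.1.1 h2).symm, ((hkzero _ y₀ hx₀ hy₀ hy₀').1 h1).symm⟩
    · intro x hx hxx
      have h1 : y₀ < x⁻¹ := (lt_inv_comm₀ hy₀ (one_pos.trans hx)).2 (by rwa [← one_div])
      have h2 := hαneg _ h1 (inv_lt_one_of_one_lt₀ hx)
      rw [← GasDyn.transmittedDefect_inv hx, ← (hk x hx).2.2,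
        (hkanti x hx).lt_iff_gt (hinv x hx) (hkmem x hx)] at h2
      have h3 := (GasDyn.jumpDefect_sign_of_transmittedDefect_eq_zero ha hx (hk x hx).1
        (hk x hx).2.2).1 h2
      exact ⟨(hsign x _ hx (hk x hx).1 (hk x hx).2.1).2.2.1 h3, by rwa [one_div]⟩
    · intro x hxx
      have hx := hx₀.trans hxx
      have h1 : x⁻¹ < y₀ := (inv_lt_comm₀ (one_pos.trans hx) hy₀).2 (by rwa [← one_div])
      have h2 := hαpos _ (hinv x hx).1 h1
      rw [← GasDyn.transmittedDefect_inv hx, ← (hk x hx).2.2,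
        (hkanti x hx).lt_iff_gt (hkmem x hx) (hinv x hx)] at h2
      have h3 := (GasDyn.jumpDefect_sign_of_transmittedDefect_eq_zero ha hx (hk x hx).1
        (hk x hx).2.2).2 h2
      exact ⟨(hsign x _ hx (hk x hx).1 (hk x hx).2.1).1.1 h3, by rwa [one_div]⟩
    · obtain ⟨r, hr, hr1, hpos, hneg⟩ := GasDyn.exists_strongShockDefect_sign ha ha'
      have hr' : GasDyn.yHat γ < r := by
        rwa [GasDyn.yHat, GasDyn.one_div_zetaPar, GasDyn.zetaPar]
      have hζ : √(GasDyn.aPar γ / (1 + GasDyn.aPar γ)) ≤ 1 :=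
        Real.sqrt_le_one.2 ((div_le_one (by positivity)).2 (by linarith))
      have hr0 : 0 < r := lt_of_le_of_lt (Real.rpow_nonneg (by linarith) _) hr
      exact ⟨r, hr', hr1, GasDyn.tendsto_atTop_zero_of_jumpDefect ha hr0 hr1 hpos hneg
        fun x y hx hy hy' => ⟨(hsign x y hx hy hy').1.1, (hsign x y hx hy hy').2.2.1⟩⟩
    · rw [GasDyn.yOne, GasDyn.one_div_zetaPar]
      exact GasDyn.tendsto_zero_of_jumpDefect ha ha'
        fun x y hx hy hy' => (hsign x y hx hy hy').2.1.1
    · rw [GasDyn.yOne, GasDyn.one_div_zetaPar]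
      have h1 : 0 < 1 - GasDyn.aPar γ := by linarith
      refine Real.rpow_lt_one (by positivity) ?_ (by positivity)
      rw [div_lt_one (by positivity)]
      linarith
  · intro x y hx hx' hy
    exact (GasDyn.forwardStrength_iff hγ₁ hx (one_pos.trans hy)).2.2.2
      (GasDyn.jumpDefect_neg_of_rarefaction_shock ha ha' hx hx' hy)
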